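/- **Setting.** Let $X\subset\mathbb C$ be a perfect compact set. Derivatives of functions on $X$ are complex derivatives relative to $X$, i.e. $f'(z)=\lim_{w\to z,\,w\in X}\frac{f(w)-f(z)}{w-z}$; $D^\infty(X)$ is the set of infinitely differentiable functions $X\to\mathbb C$, and $\|\cdot\|_\infty$ is the supremum norm on $X$. A weight sequence is a sequence $(M_n)_{n\ge 0}$ of positive numbers with $M_0=1$ and $\frac{M_{n+m}}{M_nM_m}\ge\binom{n+m}{m}$ for all $n,m\ge 0$; it is nonanalytic if $\lim_{n\to\infty}(n!/M_n)^{1/n}=0$. Let $$D(X,M)=\Big\{f\in D^\infty(X):\ \|f\|_D=\sum_{n=0}^\infty\frac{\|f^{(n)}\|_\infty}{M_n}<\infty\Big\},$$ a normed algebra under the pointwise operations. Its maximal ideal space is said to be $X$ if every character of $D(X,M)$ (unital algebra homomorphism $D(X,M)\to\mathbb C$) is evaluation at exactly one point of $X$. A selfmap $\varphi:X\to X$ is analytic if it is infinitely differentiable on $X$ and $\sup_{k\ge1}\big(\|\varphi^{(k)}\|_\infty/k!\big)^{1/k}<\infty$. An endomorphism $T$ of $D(X,M)$ is induced by $\varphi$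 if $Tf=f\circ\varphi$ for all $f\in D(X,M)$. A bounded linear operator $T$ on a complex Banach space $B$ is a Riesz operator if: for each $\lambda\ne0$, (a) $\lambda-T$ is open as a map onto its range, (b) $(\lambda-T)(B)$ is closed, (c) the dimension of the kernel and the codimension of the range of $\lambda-T$ are finite and equal, (d) the null chain $(\ker(\lambda-T)^n)_n$ and the image chain $((\lambda-T)^n(B))_n$ have finite and equal lengths; and (e) the nonzero spectrum of $T$ consists of eigenvalues which, if there are infinitely many of them, form a sequence converging to $0$. $T$ is power compact if $T^N$ is a compact operator for some positive integer $N$. **Theorem 2.3.** Let $X$ be a connected (nonempty) perfect compact subset of the complex plane and $(M_n)$ a nonanalytic weight sequence. If $D(X,M)$ is a Banach algebra (i.e. complete) whose maximal ideal space is $X$, then every Riesz endomorphism of $D(X,M)$ (an endomorphism that is a Riesz operator) induced by an analytic selfmap $\varphi$ of $X$ is power compact. -/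

import Mathlib

open Set Filter Topology

/-! ### Differentiation on compact subsets of the plane -/

/-- A function on `X ⊆ ℂ`, extended by `0` to the whole plane.  Derivatives at points of `X` are
always taken relative to `X` below, so that the values off `X` play no role. -/
noncomputable def planeExt {X : Set ℂ} (f : X → ℂ) : ℂ → ℂ :=
  Function.extend Subtype.val f 0

/-- The `k`-th complex derivative of `f : X → ℂ` relative to `X`; thus
`f'(z) = lim_{w → z, w ∈ X} (f w - f z) / (w - z)`. -/
noncomputable def relDeriv {X : Set ℂ} (k : ℕ) (f : X → ℂ) : X → ℂ :=
  fun x => iteratedDerivWithin k (planeExt f) X x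

/-- `f ∈ D^∞(X)`: the function `f : X → ℂ` is infinitely (complex) differentiable on `X`. -/
def IsSmoothOn {X : Set ℂ} (f : X → ℂ) : Prop :=
  ∀ k : ℕ, DifferentiableOn ℂ (iteratedDerivWithin k (planeExt f) X) X

/-- The uniform norm `‖f‖_∞` of a function on `X`. -/
noncomputable def unifNorm {X : Set ℂ} (f : X → ℂ) : ℝ := ⨆ x : X, ‖f x‖

/-! ### Weight sequences -/

/-- A weight sequence: positive numbers with `M 0 = 1` and
`M (n + m) / (M n * M m) ≥ (n + m).choose m`. -/
structure IsWeightSequence (M : ℕ → ℝ) : Prop where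
  pos : ∀ n, 0 < M n
  zero : M 0 = 1
  choose_le : ∀ n m, ((n + m).choose m : ℝ) ≤ M (n + m) / (M n * M m)

/-- The weight sequence is nonanalytic: `lim (n! / M n) ^ (1 / n) = 0`. -/
def IsNonanalytic (M : ℕ → ℝ) : Prop :=
  Tendsto (fun n : ℕ => ((n.factorial : ℝ) / M n) ^ (1 / (n : ℝ))) atTop (𝓝 0)

/-! ### Dales-Davie algebras -/

/-- The terms `‖f^(n)‖_∞ / M n` whose sum is the norm of `f` in `D(X, M)`. -/
noncomputable def ddTerm {X : Set ℂ} (M : ℕ → ℝ) (f : X → ℂ) (n : ℕ) : ℝ :=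
  unifNorm (relDeriv n f) / M n

/-- Membership in `D(X, M)`: `f` is infinitely differentiable on `X` and
`∑ ‖f^(n)‖_∞ / M n < ∞`. -/
def MemDD {X : Set ℂ} (M : ℕ → ℝ) (f : X → ℂ) : Prop :=
  IsSmoothOn f ∧ Summable (ddTerm M f)

section Helpers

theorem planeExt_coe {X : Set ℂ} (f : X → ℂ) (x : X) : planeExt f (x : ℂ) = f x :=
  Subtype.val_injective.extend_apply f 0 x

theorem planeExt_off {X : Set ℂ} (f : X → ℂ) {z : ℂ} (hz : z ∉ X) : planeExt f z = 0 :=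
  Function.extend_apply' f (0 : ℂ → ℂ) z (fun ⟨a, ha⟩ => hz (ha ▸ a.2))

theorem planeExt_add {X : Set ℂ} (f g : X → ℂ) :
    planeExt (f + g) = planeExt f + planeExt g := by
  ext z
  by_cases hz : z ∈ X
  · simpa using planeExt_coe (f + g) ⟨z, hz⟩ |>.trans
      (congrArg₂ (· + ·) (planeExt_coe f ⟨z, hz⟩) (planeExt_coe g ⟨z, hz⟩)).symm
  · simp [planeExt_off _ hz]

theorem planeExt_mul {X : Set ℂ} (f g : X → ℂ) :
    planeExt (f * g) = planeExt f * planeExt g := by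
  ext z
  by_cases hz : z ∈ X
  · simpa using planeExt_coe (f * g) ⟨z, hz⟩ |>.trans
      (congrArg₂ (· * ·) (planeExt_coe f ⟨z, hz⟩) (planeExt_coe g ⟨z, hz⟩)).symm
  · simp [planeExt_off _ hz]

theorem planeExt_smul {X : Set ℂ} (c : ℂ) (f : X → ℂ) :
    planeExt (c • f) = c • planeExt f := by
  ext z
  by_cases hz : z ∈ X
  · simpa using planeExt_coe (c • f) ⟨z, hz⟩ |>.trans
      (congrArg (c * ·) (planeExt_coe f ⟨z, hz⟩)).symm
  · simp [planeExt_off _ hz]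

theorem planeExt_const {X : Set ℂ} (c : ℂ) :
    EqOn (planeExt (fun _ : X => c)) (fun _ => c) X :=
  fun z hz => planeExt_coe (fun _ : X => c) ⟨z, hz⟩

theorem Perfect.uniqueDiffOn_plane {X : Set ℂ} (hX : Perfect X) : UniqueDiffOn ℂ X :=
  fun x hx => uniqueDiffWithinAt_iff_accPt.2 (hX.acc x hx)

theorem isSmoothOn_iff {X : Set ℂ} (hX : Perfect X) (f : X → ℂ) :
    IsSmoothOn f ↔ ContDiffOn ℂ (⊤ : ℕ∞) (planeExt f) X := by
  constructor
  · exact fun h => contDiffOn_of_differentiableOn_deriv fun m _ => h m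
  · exact fun h k => h.differentiableOn_iteratedDerivWithin
      (by exact_mod_cast WithTop.coe_lt_top k) hX.uniqueDiffOn_plane

theorem IsSmoothOn.contDiffWithinAt {X : Set ℂ} (hX : Perfect X) {f : X → ℂ}
    (hf : IsSmoothOn f) (n : ℕ) (x : X) : ContDiffWithinAt ℂ n (planeExt f) X x :=
  ((isSmoothOn_iff hX f).1 hf x x.2).of_le (by exact_mod_cast le_top)

theorem IsSmoothOn.continuous_relDeriv {X : Set ℂ} {f : X → ℂ} (hf : IsSmoothOn f) (n : ℕ) :
    Continuous (relDeriv n f) :=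
  continuousOn_iff_continuous_domRestrict.1 (hf n).continuousOn

theorem unifNorm_nonneg {X : Set ℂ} (f : X → ℂ) : 0 ≤ unifNorm f :=
  Real.iSup_nonneg fun _ => norm_nonneg _

theorem norm_le_unifNorm {X : Set ℂ} (hX : IsCompact X) {f : X → ℂ} (hf : Continuous f) (x : X) :
    ‖f x‖ ≤ unifNorm f := by
  have : CompactSpace X := isCompact_iff_compactSpace.1 hX
  exact le_ciSup (isCompact_range hf.norm).bddAbove x

theorem unifNorm_le {X : Set ℂ} {f : X → ℂ} {c : ℝ} (hc : 0 ≤ c) (h : ∀ x, ‖f x‖ ≤ c) :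
    unifNorm f ≤ c := Real.iSup_le h hc

theorem ddTerm_nonneg {X : Set ℂ} {M : ℕ → ℝ} (hM : IsWeightSequence M) (f : X → ℂ) (n : ℕ) :
    0 ≤ ddTerm M f n := div_nonneg (unifNorm_nonneg _) (hM.pos n).le

theorem MemDD.add {X : Set ℂ} {M : ℕ → ℝ} (hX : IsCompact X) (hP : Perfect X)
    (hM : IsWeightSequence M) {f g : X → ℂ} (hf : MemDD M f) (hg : MemDD M g) :
    MemDD M (f + g) ∧ ∀ n, ddTerm M (f + g) n ≤ ddTerm M f n + ddTerm M g n := by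
  have h : ∀ n, ddTerm M (f + g) n ≤ ddTerm M f n + ddTerm M g n := by
    intro n
    rw [ddTerm, ddTerm, ddTerm, ← add_div]
    refine div_le_div_of_nonneg_right ?_ (hM.pos n).le
    refine unifNorm_le (add_nonneg (unifNorm_nonneg _) (unifNorm_nonneg _)) fun x => ?_
    have : relDeriv n (f + g) x = relDeriv n f x + relDeriv n g x := by
      simp only [relDeriv, planeExt_add]
      exact iteratedDerivWithin_add x.2 hP.uniqueDiffOn_plane
        (hf.1.contDiffWithinAt hP n x) (hg.1.contDiffWithinAt hP n x)
    rw [this]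
    exact (norm_add_le _ _).trans (add_le_add
      (norm_le_unifNorm hX (hf.1.continuous_relDeriv n) x)
      (norm_le_unifNorm hX (hg.1.continuous_relDeriv n) x))
  refine ⟨⟨?_, ?_⟩, h⟩
  · rw [isSmoothOn_iff hP, planeExt_add]
    exact ((isSmoothOn_iff hP f).1 hf.1).add ((isSmoothOn_iff hP g).1 hg.1)
  · exact (hf.2.add hg.2).of_nonneg_of_le (fun n => ddTerm_nonneg hM _ n) h

theorem ddTerm_smul {X : Set ℂ} (M : ℕ → ℝ) (c : ℂ) (f : X → ℂ) (n : ℕ) :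
    ddTerm M (c • f) n = ‖c‖ * ddTerm M f n := by
  have : ∀ x, ‖relDeriv n (c • f) x‖ = ‖c‖ * ‖relDeriv n f x‖ := by
    intro x
    simp [relDeriv, planeExt_smul]
  simp only [ddTerm, unifNorm, this]
  rw [← Real.mul_iSup_of_nonneg (norm_nonneg c), mul_div_assoc]

theorem MemDD.smul {X : Set ℂ} {M : ℕ → ℝ} (hP : Perfect X) (c : ℂ) {f : X → ℂ}
    (hf : MemDD M f) : MemDD M (c • f) := by
  refine ⟨?_, ?_⟩
  · rw [isSmoothOn_iff hP, planeExt_smul]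
    exact ((isSmoothOn_iff hP f).1 hf.1).const_smul c
  · rw [show ddTerm M (c • f) = fun n => ‖c‖ * ddTerm M f n from funext (ddTerm_smul M c f)]
    exact hf.2.mul_left _

theorem memDD_const {X : Set ℂ} (M : ℕ → ℝ) (hP : Perfect X) (c : ℂ) :
    MemDD M (fun _ : X => c) := by
  refine ⟨?_, ?_⟩
  · rw [isSmoothOn_iff hP]
    exact contDiffOn_const.congr (planeExt_const c)
  · refine summable_of_ne_finset_zero (s := {0}) fun n hn => ?_
    have hn : n ≠ 0 := by simpa using hn
    have : ∀ x, relDeriv n (fun _ : X => c) x = 0 := by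
      intro x
      rw [relDeriv, iteratedDerivWithin_congr (planeExt_const c) x.2, iteratedDerivWithin_const,
        if_neg hn]
    simp [ddTerm, unifNorm, this]

theorem MemDD.mul {X : Set ℂ} {M : ℕ → ℝ} (hX : IsCompact X) (hP : Perfect X)
    (hM : IsWeightSequence M) {f g : X → ℂ} (hf : MemDD M f) (hg : MemDD M g) :
    MemDD M (f * g) ∧
      ∑' n, ddTerm M (f * g) n ≤ (∑' n, ddTerm M f n) * ∑' n, ddTerm M g n := by
  have hf' : Summable fun n => ‖ddTerm M f n‖ := hf.2.norm
  have hg' : Summable fun n => ‖ddTerm M g n‖ := hg.2.norm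
  have hs := (summable_norm_sum_mul_antidiagonal_of_summable_norm hf' hg').of_norm
  have h : ∀ n, ddTerm M (f * g) n ≤
      ∑ kl ∈ Finset.HasAntidiagonal.antidiagonal n, ddTerm M f kl.1 * ddTerm M g kl.2 := by
    intro n
    rw [ddTerm, div_le_iff₀ (hM.pos n)]
    refine unifNorm_le (mul_nonneg (Finset.sum_nonneg fun kl _ => mul_nonneg
      (ddTerm_nonneg hM _ _) (ddTerm_nonneg hM _ _)) (hM.pos n).le) fun x => ?_
    have e : relDeriv n (f * g) x = ∑ i ∈ Finset.range (n + 1),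
        (n.choose i : ℂ) * relDeriv i f x * relDeriv (n - i) g x := by
      simp only [relDeriv, planeExt_mul]
      exact iteratedDerivWithin_mul x.2 hP.uniqueDiffOn_plane
        (hf.1.contDiffWithinAt hP n x) (hg.1.contDiffWithinAt hP n x)
    rw [e, Finset.Nat.sum_antidiagonal_eq_sum_range_succ
      (fun i j => ddTerm M f i * ddTerm M g j) n, Finset.sum_mul]
    refine (norm_sum_le _ _).trans (Finset.sum_le_sum fun i hi => ?_)
    have hi : i ≤ n := Nat.lt_succ_iff.1 (Finset.mem_range.1 hi)
    have hw : (n.choose i : ℝ) ≤ M n / (M i * M (n - i)) := by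
      have := hM.choose_le (n - i) i
      rwa [Nat.sub_add_cancel hi, mul_comm] at this
    have h1 := norm_le_unifNorm hX (hf.1.continuous_relDeriv i) x
    have h2 := norm_le_unifNorm hX (hg.1.continuous_relDeriv (n - i)) x
    have hp1 := hM.pos i
    have hp2 := hM.pos (n - i)
    calc ‖(n.choose i : ℂ) * relDeriv i f x * relDeriv (n - i) g x‖
        = (n.choose i : ℝ) * ‖relDeriv i f x‖ * ‖relDeriv (n - i) g x‖ := by simp
      _ ≤ (M n / (M i * M (n - i))) * unifNorm (relDeriv i f) * unifNorm (relDeriv (n - i) g) := by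
          have := (hM.pos n).le
          have := unifNorm_nonneg (relDeriv i f)
          gcongr
      _ = ddTerm M f i * ddTerm M g (n - i) * M n := by
          simp only [ddTerm]
          field_simp
  have hsum : Summable (ddTerm M (f * g)) :=
    hs.of_nonneg_of_le (fun n => ddTerm_nonneg hM _ n) h
  refine ⟨⟨?_, hsum⟩, ?_⟩
  · rw [isSmoothOn_iff hP, planeExt_mul]
    exact ((isSmoothOn_iff hP f).1 hf.1).mul ((isSmoothOn_iff hP g).1 hg.1)
  · rw [tsum_mul_tsum_eq_tsum_sum_antidiagonal_of_summable_norm hf' hg']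
    exact hsum.tsum_le_tsum h hs

end Helpers

/-- `D(X, M)` as a subalgebra of the algebra of all functions `X → ℂ` with the pointwise
operations. -/
def ddSubalgebra (X : Set ℂ) (M : ℕ → ℝ) (hX : IsCompact X) (hP : Perfect X)
    (hM : IsWeightSequence M) : Subalgebra ℂ (X → ℂ) where
  carrier := {f | MemDD M f}
  mul_mem' hf hg := (MemDD.mul hX hP hM hf hg).1
  add_mem' hf hg := (MemDD.add hX hP hM hf hg).1
  algebraMap_mem' c := memDD_const M hP c

/-- The Dales-Davie algebra `D(X, M)`. -/
def DalesDavie (X : Set ℂ) (M : ℕ → ℝ) (hX : IsCompact X) (hP : Perfect X)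
    (hM : IsWeightSequence M) : Type :=
  ddSubalgebra X M hX hP hM

namespace DalesDavie

variable {X : Set ℂ} {M : ℕ → ℝ} {hX : IsCompact X} {hP : Perfect X} {hM : IsWeightSequence M}

noncomputable instance : CommRing (DalesDavie X M hX hP hM) :=
  inferInstanceAs (CommRing (ddSubalgebra X M hX hP hM))

noncomputable instance : Algebra ℂ (DalesDavie X M hX hP hM) :=
  inferInstanceAs (Algebra ℂ (ddSubalgebra X M hX hP hM))

instance : CoeFun (DalesDavie X M hX hP hM) fun _ => X → ℂ := ⟨fun f => f.1⟩

/-- The norm `‖f‖_D = ∑ ‖f^(n)‖_∞ / M n`. -/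
noncomputable def ringNorm : RingNorm (DalesDavie X M hX hP hM) where
  toFun f := ∑' n, ddTerm M f n
  map_zero' := by
    have : ∀ n, ddTerm M (0 : X → ℂ) n = 0 := fun n => by
      simpa using ddTerm_smul M 0 (0 : X → ℂ) n
    exact (tsum_congr this).trans tsum_zero
  add_le' f g := by
    obtain ⟨h1, h2⟩ := MemDD.add hX hP hM f.2 g.2
    rw [← f.2.2.tsum_add g.2.2]
    exact h1.2.tsum_le_tsum h2 (f.2.2.add g.2.2)
  neg' f := by
    refine tsum_congr fun n => ?_
    have := ddTerm_smul M (-1) (f : X → ℂ) n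
    rw [neg_one_smul, norm_neg, norm_one, one_mul] at this
    exact this
  mul_le' f g := (MemDD.mul hX hP hM f.2 g.2).2
  eq_zero_of_map_eq_zero' f hf := by
    have h0 := (hasSum_zero_iff_of_nonneg (fun n => ddTerm_nonneg hM (f : X → ℂ) n)).1
      (hf ▸ f.2.2.hasSum)
    have h1 : unifNorm (relDeriv 0 (f : X → ℂ)) = 0 := by
      have := congrFun h0 0
      simpa [ddTerm, hM.zero] using this
    refine Subtype.ext (funext fun x => ?_)
    have h2 := norm_le_unifNorm hX (f.2.1.continuous_relDeriv 0) x
    rw [h1, norm_le_zero_iff, relDeriv, iteratedDerivWithin_zero, planeExt_coe] at h2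
    exact h2

noncomputable instance : NormedRing (DalesDavie X M hX hP hM) :=
  RingNorm.toNormedRing ringNorm

noncomputable instance : NormedCommRing (DalesDavie X M hX hP hM) where
  mul_comm := mul_comm

theorem norm_def (f : DalesDavie X M hX hP hM) :
    ‖f‖ = ∑' n, unifNorm (relDeriv n (f : X → ℂ)) / M n := rfl

noncomputable instance : NormedAlgebra ℂ (DalesDavie X M hX hP hM) where
  norm_smul_le c f := by
    refine le_of_eq ?_
    refine (tsum_congr fun n => ddTerm_smul M c (f : X → ℂ) n).trans ?_
    exact tsum_mul_left

/-- Evaluation at a point of `X`, a character of `D(X, M)`. -/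
def eval (x : X) : DalesDavie X M hX hP hM →ₐ[ℂ] ℂ where
  toFun f := f x
  map_one' := rfl
  map_mul' _ _ := rfl
  map_zero' := rfl
  map_add' _ _ := rfl
  commutes' _ := rfl

/-- The maximal ideal space of `D(X, M)` is `X`: every character is the evaluation at exactly one
point of `X`. -/
def MaximalIdealSpaceIs (X : Set ℂ) (M : ℕ → ℝ) (hX : IsCompact X) (hP : Perfect X)
    (hM : IsWeightSequence M) : Prop :=
  Function.Bijective (eval : X → (DalesDavie X M hX hP hM →ₐ[ℂ] ℂ))

end DalesDavie

/-- A selfmap `φ` of `X` is analytic: it is infinitely differentiable on `X` and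
`sup_{k ≥ 1} (‖φ^(k)‖_∞ / k!) ^ (1 / k) < ∞`. -/
def IsAnalyticSelfmap {X : Set ℂ} (φ : X → X) : Prop :=
  IsSmoothOn (fun x => (φ x : ℂ)) ∧
  BddAbove {r : ℝ | ∃ k : ℕ, 1 ≤ k ∧
    r = (unifNorm (relDeriv k fun x => (φ x : ℂ)) / (k.factorial : ℝ)) ^ (1 / (k : ℝ))}

/-! ### Riesz operators -/

/-- A bounded operator `T` on a Banach space is a Riesz operator. -/
structure IsRieszOperator {E : Type*} [NormedAddCommGroup E] [NormedSpace ℂ E]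
    (T : E →L[ℂ] E) : Prop where
  /-- For `c ≠ 0`, `c - T` is open (as a map onto its range). -/
  isOpen : ∀ c : ℂ, c ≠ 0 → IsOpenMap (rangeFactorization (algebraMap ℂ (E →L[ℂ] E) c - T))
  /-- For `c ≠ 0`, the range of `c - T` is closed. -/
  isClosed_range : ∀ c : ℂ, c ≠ 0 → IsClosed (range (algebraMap ℂ (E →L[ℂ] E) c - T))
  /-- For `c ≠ 0`, the dimension of the kernel and the codimension of the range of `c - T` are
  finite and equal. -/
  finite_ker : ∀ c : ℂ, c ≠ 0 →
    FiniteDimensional ℂ (algebraMap ℂ (Module.End ℂ E) c - (T : Module.End ℂ E)).ker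
  finite_coker : ∀ c : ℂ, c ≠ 0 →
    FiniteDimensional ℂ (E ⧸ (algebraMap ℂ (Module.End ℂ E) c - (T : Module.End ℂ E)).range)
  finrank_eq : ∀ c : ℂ, c ≠ 0 →
    Module.finrank ℂ (algebraMap ℂ (Module.End ℂ E) c - (T : Module.End ℂ E)).ker =
      Module.finrank ℂ (E ⧸ (algebraMap ℂ (Module.End ℂ E) c - (T : Module.End ℂ E)).range)
  /-- For `c ≠ 0`, the null chain and the image chain of `c - T` have finite and equal lengths. -/
  chains : ∀ c : ℂ, c ≠ 0 → ∃ p : ℕ,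
    IsLeast {n : ℕ | ((algebraMap ℂ (Module.End ℂ E) c - (T : Module.End ℂ E)) ^ n).ker =
      ((algebraMap ℂ (Module.End ℂ E) c - (T : Module.End ℂ E)) ^ (n + 1)).ker} p ∧
    IsLeast {n : ℕ | ((algebraMap ℂ (Module.End ℂ E) c - (T : Module.End ℂ E)) ^ n).range =
      ((algebraMap ℂ (Module.End ℂ E) c - (T : Module.End ℂ E)) ^ (n + 1)).range} p
  /-- The non-zero spectrum consists of eigenvalues. -/
  hasEigenvalue : ∀ c ∈ spectrum ℂ T, c ≠ 0 → Module.End.HasEigenvalue (T : Module.End ℂ E) c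
  /-- If the non-zero spectrum is infinite, it forms a sequence approaching `0`. -/
  tendsto_zero : (spectrum ℂ T \ {0}).Infinite → ∃ u : ℕ → ℂ,
    Function.Injective u ∧ range u = spectrum ℂ T \ {0} ∧ Tendsto u atTop (𝓝 0)

/-- `T` is power compact: `T ^ N` is compact for some positive integer `N`. -/
def IsPowerCompact {E : Type*} [NormedAddCommGroup E] [NormedSpace ℂ E] (T : E →L[ℂ] E) : Prop :=
  ∃ N : ℕ, 0 < N ∧ IsCompactOperator (T ^ N)

/-! ### Iterated derivatives of compositions relative to a set -/

section Composition

variable {X : Set ℂ} {f φ : ℂ → ℂ}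

/-! The Riesz condition forces the iterates of `φ` to contract `X` to one attracting fixed point,
and composition with an analytic contraction is compact.

Dynamics. Functions fixed by `T` form a subalgebra that is finite-dimensional, being `ker (1 - T)`;
its elements are algebraic, so they take finitely many values and are constant by connectedness
(`eq_smul_one_of_fixed`). If `f` is an eigenfunction for `c` with `1 ≤ ‖c‖`, its powers are
eigenfunctions for the powers of `c`; only finitely many spectral values lie off the open unit disc,
so `c` is a root of unity, a power of `f` is constant, and `c = 1` (`eq_one_of_mem_spectrum`). The
null chain at `1` has length at most one (`sub_eq_zero_of_sub_fixed`), so the space splits as the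
constants plus the range of `1 - T`, and `T` has spectral radius below one on that range. Splitting
the coordinate function gives uniform convergence of the iterates to a point
(`exists_tendsto_iterate`). Comparing kernel and cokernel of `1 - T` shows that `φ'` has modulus
below one there (`norm_relDeriv_one_fixed_lt_one`), so some iterate has derivative of sup norm below
one.

Compactness. For such an iterate, Taylor majorants and nonanalyticity of the weights give a bound
with extra factors `η ^ n`, `1 < η`, in the norm series (`exists_weighted_ddTerm_comp_le`). Tails
are thus uniformly small, while each single derivative is handled by Arzelà–Ascoli
(`isCompactOperator_of_weighted`). -/

theorem iteratedDerivWithin_comp_eq_zero (hX : UniqueDiffOn ℂ X)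
    (hφ : ContDiffOn ℂ (⊤ : ℕ∞) φ X) (hmaps : MapsTo φ X X) {x : ℂ} (hx : x ∈ X) (n : ℕ) :
    ∀ g : ℂ → ℂ, ContDiffOn ℂ (⊤ : ℕ∞) g X →
      (∀ k ≤ n, iteratedDerivWithin k g X (φ x) = 0) →
      iteratedDerivWithin n (g ∘ φ) X x = 0 := by
  induction n using Nat.strong_induction_on with
  | _ n ih =>
    intro g hg h0
    cases n with
    | zero => simpa using h0 0 le_rfl
    | succ n =>
      have hg' : ContDiffOn ℂ (⊤ : ℕ∞) (derivWithin g X) X :=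
        hg.derivWithin hX (by simp)
      have hφ' : ContDiffOn ℂ (⊤ : ℕ∞) (derivWithin φ X) X :=
        hφ.derivWithin hX (by simp)
      -- By the chain rule and Leibniz, only derivatives of `g' ∘ φ` of order at most `n` occur. The
      -- induction therefore varies `g` and is applied to `g'`.
      have hchain : EqOn (derivWithin (g ∘ φ) X) ((derivWithin g X ∘ φ) * derivWithin φ X) X := by
        intro z hz
        exact derivWithin_comp z ((hg.differentiableOn (by simp)) _ (hmaps hz))
          ((hφ.differentiableOn (by simp)) _ hz) hmaps
      rw [iteratedDerivWithin_succ', iteratedDerivWithin_congr hchain hx,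
        iteratedDerivWithin_mul hx hX
          (((hg'.comp hφ hmaps) x hx).of_le (by exact_mod_cast le_top))
          ((hφ' x hx).of_le (by exact_mod_cast le_top))]
      refine Finset.sum_eq_zero fun i hi => ?_
      have hi : i < n + 1 := Finset.mem_range.1 hi
      rw [ih i hi _ hg' fun k hk => ?_]
      · simp
      · rw [← iteratedDerivWithin_succ']
        exact h0 _ (by omega)

theorem iteratedDerivWithin_sub_pow_self (hX : UniqueDiffOn ℂ X) {y : ℂ} (hy : y ∈ X)
    (j k : ℕ) : iteratedDerivWithin j (fun w => (w - y) ^ k) X y =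
      if j = k then (k.factorial : ℂ) else 0 := by
  rw [iteratedDerivWithin_eq_iteratedDeriv hX (by fun_prop) hy]
  have := iteratedDeriv_comp_sub_const (𝕜 := ℂ) j (fun w : ℂ => w ^ k) y
  rw [this]
  simp only [sub_self]
  rw [iteratedDeriv_fun_pow_zero]
  split_ifs <;> simp

/-- A form of Faà di Bruno without partitions: `f` may be replaced by its Taylor polynomial `p` of
degree `n` at `φ x`, because `f - p` vanishes there to order `n`, and `p ∘ φ` is a combination of
powers of `φ - φ x`. -/
theorem iteratedDerivWithin_comp_eq_sum (hX : UniqueDiffOn ℂ X)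
    (hf : ContDiffOn ℂ (⊤ : ℕ∞) f X)
    (hφ : ContDiffOn ℂ (⊤ : ℕ∞) φ X) (hmaps : MapsTo φ X X) {x : ℂ} (hx : x ∈ X) (n : ℕ) :
    iteratedDerivWithin n (f ∘ φ) X x = ∑ k ∈ Finset.range (n + 1),
      iteratedDerivWithin k f X (φ x) / (k.factorial : ℂ) *
        iteratedDerivWithin n (fun z => (φ z - φ x) ^ k) X x := by
  set y := φ x with hy
  have hyX : y ∈ X := hmaps hx
  set p : ℂ → ℂ := fun w => ∑ k ∈ Finset.range (n + 1),
    iteratedDerivWithin k f X y / (k.factorial : ℂ) * (w - y) ^ k with hp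
  have hpc : ContDiff ℂ (⊤ : ℕ∞) p := by
    rw [hp]; fun_prop
  have hpd : ∀ j ≤ n, iteratedDerivWithin j p X y = iteratedDerivWithin j f X y := by
    intro j hj
    rw [hp, iteratedDerivWithin_fun_sum hyX hX (fun k _ => by fun_prop)]
    simp_rw [iteratedDerivWithin_const_mul_field, iteratedDerivWithin_sub_pow_self hX hyX]
    have hj' : j ∈ Finset.range (n + 1) := Finset.mem_range.2 (by omega)
    rw [Finset.sum_eq_single_of_mem j hj' (fun b _ hb => by simp [hb.symm])]
    rw [if_pos rfl, div_mul_cancel₀ _ (by exact_mod_cast j.factorial_ne_zero)]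
  have hnat : ∀ {u : ℂ → ℂ}, ContDiffOn ℂ (⊤ : ℕ∞) u X → ∀ (m : ℕ), ∀ z ∈ X,
      ContDiffWithinAt ℂ m u X z :=
    fun hu m z hz => (hu z hz).of_le (by exact_mod_cast le_top)
  have hdiff : iteratedDerivWithin n ((f - p) ∘ φ) X x = 0 := by
    refine iteratedDerivWithin_comp_eq_zero hX hφ hmaps hx n _ (hf.sub hpc.contDiffOn) ?_
    intro k hk
    rw [iteratedDerivWithin_sub hyX hX (hnat hf k y hyX) (hnat hpc.contDiffOn k y hyX), hpd k hk,
      sub_self]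
  have hsub : (f - p) ∘ φ = f ∘ φ - p ∘ φ := rfl
  rw [hsub, iteratedDerivWithin_sub hx hX (hnat (hf.comp hφ hmaps) n x hx)
    (hnat (hpc.comp_contDiffOn hφ) n x hx), sub_eq_zero] at hdiff
  rw [hdiff]
  have : p ∘ φ = fun z => ∑ k ∈ Finset.range (n + 1),
    iteratedDerivWithin k f X y / (k.factorial : ℂ) * (φ z - y) ^ k := rfl
  have hpow : ∀ k : ℕ, ContDiffOn ℂ (⊤ : ℕ∞) (fun z => (φ z - y) ^ k) X :=
    fun k => (hφ.sub contDiffOn_const).pow k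
  rw [this, iteratedDerivWithin_fun_sum hx hX
    (fun k _ => hnat (contDiffOn_const.mul (hpow k)) n x hx)]
  simp_rw [iteratedDerivWithin_const_mul_field]

theorem iteratedDerivWithin_mul_div_factorial (hX : UniqueDiffOn ℂ X) {u v : ℂ → ℂ}
    (hu : ContDiffOn ℂ (⊤ : ℕ∞) u X) (hv : ContDiffOn ℂ (⊤ : ℕ∞) v X)
    {x : ℂ} (hx : x ∈ X) (n : ℕ) :
    iteratedDerivWithin n (u * v) X x / (n.factorial : ℂ) =
      ∑ ij ∈ Finset.HasAntidiagonal.antidiagonal n, iteratedDerivWithin ij.1 u X x / (ij.1.factorial : ℂ) *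
        (iteratedDerivWithin ij.2 v X x / (ij.2.factorial : ℂ)) := by
  rw [iteratedDerivWithin_mul hx hX ((hu x hx).of_le (by exact_mod_cast le_top))
    ((hv x hx).of_le (by exact_mod_cast le_top)),
    Finset.Nat.sum_antidiagonal_eq_sum_range_succ (fun i j =>
      iteratedDerivWithin i u X x / (i.factorial : ℂ) *
        (iteratedDerivWithin j v X x / (j.factorial : ℂ))), Finset.sum_div]
  refine Finset.sum_congr rfl fun i hi => ?_
  have hi : i ≤ n := Nat.lt_succ_iff.1 (Finset.mem_range.1 hi)
  rw [Nat.cast_choose ℂ hi]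
  have h1 : (n.factorial : ℂ) ≠ 0 := by exact_mod_cast n.factorial_ne_zero
  have h2 : (i.factorial : ℂ) ≠ 0 := by exact_mod_cast i.factorial_ne_zero
  have h3 : ((n - i).factorial : ℂ) ≠ 0 := by exact_mod_cast (n - i).factorial_ne_zero
  field_simp

/-! ### Majorant power series for powers of a function -/

theorem PowerSeries.coeff_mk_pow_nonneg {b : ℕ → ℝ} (hb : ∀ i, 0 ≤ b i) (k n : ℕ) :
    0 ≤ PowerSeries.coeff n (PowerSeries.mk b ^ k) := by
  induction k generalizing n with
  | zero => rw [pow_zero, PowerSeries.coeff_one]; split_ifs <;> norm_num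
  | succ k ih =>
    rw [pow_succ, PowerSeries.coeff_mul]
    exact Finset.sum_nonneg fun ij _ => mul_nonneg (ih _) (by simpa using hb _)

theorem PowerSeries.coeff_mk_pow_eq_zero {b : ℕ → ℝ} (hb : b 0 = 0) {k n : ℕ} (h : n < k) :
    PowerSeries.coeff n (PowerSeries.mk b ^ k) = 0 :=
  PowerSeries.X_pow_dvd_iff.1
    (pow_dvd_pow_of_dvd (PowerSeries.X_dvd_iff.2 (by simpa using hb)) k) n h

/-- Evaluation at `s` is multiplicative on absolutely convergent series, by Cauchy products. -/
theorem PowerSeries.hasSum_coeff_mk_pow {b : ℕ → ℝ} {s β : ℝ}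
    (h : HasSum (fun i => b i * s ^ i) β) (k : ℕ) :
    HasSum (fun n => PowerSeries.coeff n (PowerSeries.mk b ^ k) * s ^ n) (β ^ k) := by
  induction k with
  | zero =>
    rw [pow_zero]
    refine (hasSum_ite_eq (0 : ℕ) (1 : ℝ)).congr_fun fun n => ?_
    rw [PowerSeries.coeff_one]
    split_ifs with hn <;> simp [hn]
  | succ k ih =>
    have h1 := ih.summable.norm
    have h2 := h.summable.norm
    have h3 := summable_norm_sum_mul_antidiagonal_of_summable_norm h1 h2
    have h4 := tsum_mul_tsum_eq_tsum_sum_antidiagonal_of_summable_norm h1 h2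
    rw [ih.tsum_eq, h.tsum_eq, ← pow_succ] at h4
    rw [h4]
    refine h3.of_norm.hasSum.congr_fun fun n => ?_
    rw [pow_succ, PowerSeries.coeff_mul, Finset.sum_mul]
    refine Finset.sum_congr rfl fun ij hij => ?_
    rw [PowerSeries.coeff_mk, ← Finset.HasAntidiagonal.mem_antidiagonal.1 hij, pow_add]
    ring

/-- Derivatives divided by factorials multiply like power series coefficients, so a majorant of `u`
yields one of `u ^ k`. -/
theorem norm_iteratedDerivWithin_pow_le (hX : UniqueDiffOn ℂ X) {u : ℂ → ℂ}
    (hu : ContDiffOn ℂ (⊤ : ℕ∞) u X) {x : ℂ} (hx : x ∈ X) {b : ℕ → ℝ}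
    (hb : ∀ i, ‖iteratedDerivWithin i u X x‖ / i.factorial ≤ b i) (k n : ℕ) :
    ‖iteratedDerivWithin n (fun z => u z ^ k) X x‖ / n.factorial ≤
      PowerSeries.coeff n (PowerSeries.mk b ^ k) := by
  have hb0 : ∀ i, 0 ≤ b i := fun i => (by positivity : (0:ℝ) ≤ _).trans (hb i)
  induction k generalizing n with
  | zero =>
    simp only [pow_zero, PowerSeries.coeff_one, iteratedDerivWithin_const]
    split_ifs with hn <;> simp [hn]
  | succ k ih =>
    have e : (fun z => u z ^ (k + 1)) = (fun z => u z ^ k) * u := by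
      ext z; simp [pow_succ]
    have key := iteratedDerivWithin_mul_div_factorial hX (hu.pow k) hu hx n
    rw [pow_succ, PowerSeries.coeff_mul, e]
    have h1 : ∀ (z : ℂ) (m : ℕ), ‖z‖ / (m.factorial : ℝ) = ‖z / (m.factorial : ℂ)‖ := by simp
    rw [h1]
    refine (congrArg norm key).le.trans ((norm_sum_le _ _).trans (Finset.sum_le_sum fun ij _ => ?_))
    rw [norm_mul, ← h1, ← h1]
    refine mul_le_mul (ih _) (by simpa using hb ij.2) (by positivity)
      (PowerSeries.coeff_mk_pow_nonneg hb0 _ _)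

end Composition

/-! ### Taylor norms and composition -/

/-- The quantities `‖f^(n)‖_∞ / n!`. -/
noncomputable def taylorNorm {X : Set ℂ} (f : X → ℂ) (n : ℕ) : ℝ :=
  unifNorm (relDeriv n f) / n.factorial

/-- The quantities `‖f^(n)‖_∞ / n!` with the term of index `0` removed. -/
noncomputable def reducedTaylorNorm {X : Set ℂ} (f : X → ℂ) (n : ℕ) : ℝ :=
  if n = 0 then 0 else taylorNorm f n

section Taylor

variable {X : Set ℂ} {M : ℕ → ℝ} {f : X → ℂ} {φ : X → X}

theorem taylorNorm_nonneg (f : X → ℂ) (n : ℕ) : 0 ≤ taylorNorm f n :=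
  div_nonneg (unifNorm_nonneg _) (Nat.cast_nonneg _)

theorem reducedTaylorNorm_nonneg (f : X → ℂ) (n : ℕ) : 0 ≤ reducedTaylorNorm f n := by
  unfold reducedTaylorNorm
  split_ifs
  exacts [le_rfl, taylorNorm_nonneg f n]

theorem reducedTaylorNorm_le (f : X → ℂ) (n : ℕ) : reducedTaylorNorm f n ≤ taylorNorm f n := by
  unfold reducedTaylorNorm
  split_ifs
  exacts [taylorNorm_nonneg f n, le_rfl]

theorem planeExt_comp_eqOn (f : X → ℂ) (φ : X → X) :
    EqOn (planeExt (f ∘ φ)) (planeExt f ∘ planeExt (fun x => (φ x : ℂ))) X := by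
  intro z hz
  have h1 := planeExt_coe (f ∘ φ) ⟨z, hz⟩
  have h2 := planeExt_coe (fun x => (φ x : ℂ)) ⟨z, hz⟩
  simp only at h1 h2
  rw [h1, Function.comp_apply, Function.comp_apply, h2, planeExt_coe]

theorem mapsTo_planeExt (φ : X → X) : MapsTo (planeExt (fun x => (φ x : ℂ))) X X := by
  intro z hz
  have h2 := planeExt_coe (fun x => (φ x : ℂ)) ⟨z, hz⟩
  simp only at h2
  rw [h2]
  exact (φ _).2

theorem IsSmoothOn.comp (hP : Perfect X) (hf : IsSmoothOn f)
    (hφ : IsSmoothOn fun x => (φ x : ℂ)) : IsSmoothOn (f ∘ φ) := by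
  rw [isSmoothOn_iff hP] at *
  exact (hf.comp hφ (mapsTo_planeExt φ)).congr (planeExt_comp_eqOn f φ)

theorem relDeriv_comp_one (hP : Perfect X) (hf : IsSmoothOn f)
    (hφ : IsSmoothOn fun x => (φ x : ℂ)) (x : X) :
    relDeriv 1 (f ∘ φ) x = relDeriv 1 f (φ x) * relDeriv 1 (fun x => (φ x : ℂ)) x := by
  rw [isSmoothOn_iff hP] at hf hφ
  have h := planeExt_coe (fun x => (φ x : ℂ)) x
  simp only [relDeriv]
  rw [iteratedDerivWithin_congr (planeExt_comp_eqOn f φ) x.2, iteratedDerivWithin_one,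
    iteratedDerivWithin_one, iteratedDerivWithin_one,
    derivWithin_comp (x : ℂ) (hf.differentiableOn (by simp) _ (mapsTo_planeExt φ x.2))
      (hφ.differentiableOn (by simp) _ x.2) (mapsTo_planeExt φ), h]

/-- The expansion at `x` involves powers of `φ - φ x`, which vanishes at `x`. The majorant can
therefore drop its constant term, and it is the same for all `x`. -/
theorem taylorNorm_comp_le (hX : IsCompact X) (hP : Perfect X) (hf : IsSmoothOn f)
    (hφ : IsSmoothOn fun x => (φ x : ℂ)) (n : ℕ) :
    taylorNorm (f ∘ φ) n ≤ ∑ k ∈ Finset.range (n + 1), taylorNorm f k *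
      PowerSeries.coeff n (PowerSeries.mk (reducedTaylorNorm fun x => (φ x : ℂ)) ^ k) := by
  have hf' := (isSmoothOn_iff hP f).1 hf
  have hφ' := (isSmoothOn_iff hP _).1 hφ
  have hnn := PowerSeries.coeff_mk_pow_nonneg (reducedTaylorNorm_nonneg fun x => (φ x : ℂ))
  have hfac : (0 : ℝ) < n.factorial := by exact_mod_cast n.factorial_pos
  rw [taylorNorm, div_le_iff₀ hfac]
  refine unifNorm_le (mul_nonneg (Finset.sum_nonneg fun k _ =>
    mul_nonneg (taylorNorm_nonneg f k) (hnn k n)) hfac.le) fun x => ?_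
  rw [← div_le_iff₀ hfac]
  have hval := planeExt_coe (fun x => (φ x : ℂ)) x
  have hb : ∀ i, ‖iteratedDerivWithin i (fun z => planeExt (fun x => (φ x : ℂ)) z - φ x) X x‖ /
      i.factorial ≤ reducedTaylorNorm (fun x => (φ x : ℂ)) i := by
    intro i
    unfold reducedTaylorNorm
    split_ifs with hi
    · simp [hi, hval]
    · have : iteratedDerivWithin i (fun z => planeExt (fun x => (φ x : ℂ)) z - φ x) X x =
          relDeriv i (fun x => (φ x : ℂ)) x := by
        have h := iteratedDerivWithin_sub (n := i) x.2 hP.uniqueDiffOn_plane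
          (hφ.contDiffWithinAt hP i x) (contDiffWithinAt_const (c := (φ x : ℂ)))
        rw [iteratedDerivWithin_const, if_neg hi, sub_zero] at h
        exact h
      rw [this]
      exact div_le_div_of_nonneg_right (norm_le_unifNorm hX (hφ.continuous_relDeriv i) x)
        (Nat.cast_nonneg _)
  have key := iteratedDerivWithin_comp_eq_sum hP.uniqueDiffOn_plane hf' hφ' (mapsTo_planeExt φ)
    x.2 n
  rw [hval] at key
  rw [relDeriv, iteratedDerivWithin_congr (planeExt_comp_eqOn f φ) x.2, key]
  refine (div_le_div_of_nonneg_right (norm_sum_le _ _) hfac.le).trans ?_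
  rw [Finset.sum_div]
  refine Finset.sum_le_sum fun k _ => ?_
  rw [norm_mul, mul_div_assoc]
  refine mul_le_mul ?_ (norm_iteratedDerivWithin_pow_le hP.uniqueDiffOn_plane
    (hφ'.sub contDiffOn_const) x.2 hb k n) (by positivity) (taylorNorm_nonneg f k)
  rw [norm_div, Complex.norm_natCast]
  exact div_le_div_of_nonneg_right (norm_le_unifNorm hX (hf.continuous_relDeriv k) (φ x))
    (Nat.cast_nonneg _)

/-- Interchange of summation, done on finite sums: weighted column sums of the triangular matrix `c`
are controlled by `v`. -/
theorem summable_weighted_of_triangular_le {A B w v : ℕ → ℝ} {c : ℕ → ℕ → ℝ} (hA0 : ∀ n, 0 ≤ A n)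
    (hB0 : ∀ n, 0 ≤ B n) (hw0 : ∀ n, 0 ≤ w n) (hc0 : ∀ n k, 0 ≤ c n k)
    (hA : ∀ n, A n ≤ ∑ k ∈ Finset.range (n + 1), B k * c n k)
    (hv : ∀ k N, ∑ n ∈ Finset.range N, w n * c n k ≤ v k) (hBv : Summable fun k => B k * v k) :
    Summable (fun n => w n * A n) ∧ ∑' n, w n * A n ≤ ∑' k, B k * v k := by
  have hv0 : ∀ k, 0 ≤ v k := fun k => by simpa using hv k 0
  have key : ∀ N, ∑ n ∈ Finset.range N, w n * A n ≤ ∑' k, B k * v k := by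
    intro N
    calc ∑ n ∈ Finset.range N, w n * A n
        ≤ ∑ n ∈ Finset.range N, ∑ k ∈ Finset.range N, B k * (w n * c n k) := by
          refine Finset.sum_le_sum fun n hn => ?_
          refine (mul_le_mul_of_nonneg_left (hA n) (hw0 n)).trans ?_
          rw [Finset.mul_sum]
          refine (Finset.sum_le_sum_of_subset_of_nonneg
            (Finset.range_subset_range.2 (Finset.mem_range.1 hn)) fun k _ _ =>
            mul_nonneg (hw0 n) (mul_nonneg (hB0 k) (hc0 n k))).trans
            (Finset.sum_le_sum fun k _ => le_of_eq (by ring))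
      _ = ∑ k ∈ Finset.range N, B k * ∑ n ∈ Finset.range N, w n * c n k := by
          rw [Finset.sum_comm]
          simp_rw [Finset.mul_sum]
      _ ≤ ∑ k ∈ Finset.range N, B k * v k :=
          Finset.sum_le_sum fun k _ => mul_le_mul_of_nonneg_left (hv k N) (hB0 k)
      _ ≤ ∑' k, B k * v k := hBv.sum_le_tsum _ fun k _ => mul_nonneg (hB0 k) (hv0 k)
  exact ⟨summable_of_sum_range_le (fun n => mul_nonneg (hw0 n) (hA0 n)) key,
    Real.tsum_le_of_sum_range_le (fun n => mul_nonneg (hw0 n) (hA0 n)) key⟩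

/-- A smooth function whose formal Taylor series converge uniformly on some disc. -/
def HasTaylorRadius (f : X → ℂ) : Prop :=
  IsSmoothOn f ∧ ∃ s : ℝ, 0 < s ∧ Summable fun n => taylorNorm f n * s ^ n

theorem IsAnalyticSelfmap.hasTaylorRadius (hφ : IsAnalyticSelfmap φ) :
    HasTaylorRadius fun x => (φ x : ℂ) := by
  obtain ⟨hs, R, hR⟩ := hφ
  -- At this radius the terms of index at least `1` are bounded by powers of `1 / 2`. Index `0`,
  -- which the analyticity condition does not control, is split off.
  refine ⟨hs, 1 / (2 * (|R| + 1)), by positivity, ?_⟩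
  set b := taylorNorm fun x => (φ x : ℂ) with hb
  have hle : ∀ k, 1 ≤ k → b k ≤ (|R| + 1) ^ k := by
    intro k hk
    have h1 : b k ^ (1 / (k : ℝ)) ≤ |R| + 1 :=
      (hR ⟨k, hk, rfl⟩).trans ((le_abs_self R).trans (by linarith))
    have hk' : (k : ℝ) ≠ 0 := by positivity
    calc b k = (b k ^ (1 / (k : ℝ))) ^ k := by
          rw [← Real.rpow_natCast, ← Real.rpow_mul (taylorNorm_nonneg _ _), one_div,
            inv_mul_cancel₀ hk', Real.rpow_one]
      _ ≤ _ := pow_le_pow_left₀ (Real.rpow_nonneg (taylorNorm_nonneg _ _) _) h1 k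
  rw [← summable_nat_add_iff 1]
  refine Summable.of_nonneg_of_le (fun n => mul_nonneg (taylorNorm_nonneg _ _) (by positivity))
    (fun n => ?_) ((summable_nat_add_iff 1).2 (summable_geometric_of_lt_one
      (by norm_num : (0 : ℝ) ≤ 1 / 2) (by norm_num)))
  refine (mul_le_mul_of_nonneg_right (hle (n + 1) (by omega)) (by positivity)).trans ?_
  rw [← mul_pow]
  refine le_of_eq ?_
  congr 1
  field_simp

theorem summable_reducedTaylorNorm (s : ℝ) (hs : 0 ≤ s)
    (h : Summable fun n => taylorNorm f n * s ^ n) :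
    Summable fun n => reducedTaylorNorm f n * s ^ n :=
  h.of_nonneg_of_le (fun n => mul_nonneg (reducedTaylorNorm_nonneg f n) (by positivity))
    fun n => mul_le_mul_of_nonneg_right (reducedTaylorNorm_le f n) (by positivity)

/-- With no constant term, every term gains at least a factor `t`, and every term past the linear
one gains `t ^ 2`. The second bound shows that for small `t` the sum is nearly `taylorNorm f 1 * (t
* s)`. -/
theorem summable_reducedTaylorNorm_scale {s t : ℝ} (hs : 0 ≤ s) (ht : 0 ≤ t) (ht1 : t ≤ 1)
    (h : Summable fun n => reducedTaylorNorm f n * s ^ n) :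
    Summable (fun n => reducedTaylorNorm f n * (t * s) ^ n) ∧
    ∑' n, reducedTaylorNorm f n * (t * s) ^ n ≤
      t * ∑' n, reducedTaylorNorm f n * s ^ n ∧
    ∑' n, reducedTaylorNorm f n * (t * s) ^ n ≤
      taylorNorm f 1 * (t * s) + t ^ 2 * ∑' n, reducedTaylorNorm f n * s ^ n := by
  have h0 : ∀ n, 0 ≤ reducedTaylorNorm f n * s ^ n :=
    fun n => mul_nonneg (reducedTaylorNorm_nonneg f n) (by positivity)
  have hle : ∀ n, reducedTaylorNorm f n * (t * s) ^ n ≤ t * (reducedTaylorNorm f n * s ^ n) := by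
    intro n
    rcases Nat.eq_zero_or_pos n with rfl | hn
    · simp [reducedTaylorNorm]
    · have : t ^ n ≤ t := pow_le_of_le_one ht ht1 (by omega)
      calc _ = t ^ n * (reducedTaylorNorm f n * s ^ n) := by rw [mul_pow]; ring
        _ ≤ _ := mul_le_mul_of_nonneg_right this (h0 n)
  have hsum : Summable fun n => reducedTaylorNorm f n * (t * s) ^ n :=
    (h.mul_left t).of_nonneg_of_le
      (fun n => mul_nonneg (reducedTaylorNorm_nonneg f n) (by positivity)) hle
  refine ⟨hsum, ?_, ?_⟩
  · rw [← tsum_mul_left]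
    exact hsum.tsum_le_tsum hle (h.mul_left t)
  · have h1 : HasSum (fun n => if n = 1 then taylorNorm f 1 * (t * s) else 0)
        (taylorNorm f 1 * (t * s)) := hasSum_ite_eq 1 _
    rw [← h1.tsum_eq, ← tsum_mul_left, ← h1.summable.tsum_add (h.mul_left (t ^ 2))]
    refine hsum.tsum_le_tsum (fun n => ?_) (h1.summable.add (h.mul_left (t ^ 2)))
    rcases Nat.lt_or_ge n 2 with hn | hn
    · interval_cases n
      · simp [reducedTaylorNorm]
      · have := h0 1
        have : 0 ≤ t ^ 2 * (reducedTaylorNorm f 1 * s ^ 1) := by positivity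
        simpa [reducedTaylorNorm] using this
    · have : t ^ n ≤ t ^ 2 := pow_le_pow_of_le_one ht ht1 hn
      rw [if_neg (by omega), zero_add]
      calc _ = t ^ n * (reducedTaylorNorm f n * s ^ n) := by rw [mul_pow]; ring
        _ ≤ _ := mul_le_mul_of_nonneg_right this (h0 n)

theorem HasTaylorRadius.comp (hX : IsCompact X) (hP : Perfect X) (hf : HasTaylorRadius f)
    (hφ : HasTaylorRadius fun x => (φ x : ℂ)) : HasTaylorRadius (f ∘ φ) := by
  obtain ⟨hfs, s, hs, hfsum⟩ := hf
  obtain ⟨hφs, r, hr, hφsum⟩ := hφ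
  have hφsum := summable_reducedTaylorNorm r hr.le hφsum
  set S := ∑' n, reducedTaylorNorm (fun x => (φ x : ℂ)) n * r ^ n with hS
  have hS0 : 0 ≤ S := tsum_nonneg fun n => mul_nonneg (reducedTaylorNorm_nonneg _ n)
    (by positivity)
  -- Chosen so that `t * S ≤ s`: the majorant of `φ` at radius `t * r` then stays within the disc on
  -- which that of `f` converges.
  set t := min 1 (s / (S + 1)) with ht
  have ht0 : 0 < t := lt_min one_pos (by positivity)
  obtain ⟨hsum, hle, -⟩ := summable_reducedTaylorNorm_scale hr.le ht0.le (min_le_left _ _) hφsum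
  set β := ∑' n, reducedTaylorNorm (fun x => (φ x : ℂ)) n * (t * r) ^ n with hβ
  have hβ0 : 0 ≤ β := tsum_nonneg fun n => mul_nonneg (reducedTaylorNorm_nonneg _ n)
    (by positivity)
  have hβs : β ≤ s := by
    have h1 : t * S ≤ s / (S + 1) * (S + 1) :=
      mul_le_mul (min_le_right _ _) (by linarith) hS0 (by positivity)
    rw [div_mul_cancel₀ _ (by positivity)] at h1
    exact hle.trans h1
  refine ⟨hfs.comp hP hφs, t * r, by positivity, ?_⟩
  have := summable_weighted_of_triangular_le (taylorNorm_nonneg (f ∘ φ)) (taylorNorm_nonneg f)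
    (w := fun n => (t * r) ^ n) (v := fun k => β ^ k) (fun n => by positivity)
    (fun n k => PowerSeries.coeff_mk_pow_nonneg (reducedTaylorNorm_nonneg fun x => (φ x : ℂ)) k n)
    (taylorNorm_comp_le hX hP hfs hφs) ?_ ?_
  · simpa only [mul_comm] using this.1
  · intro k N
    have h := PowerSeries.hasSum_coeff_mk_pow hsum.hasSum k
    simp_rw [mul_comm ((t * r) ^ _)]
    exact sum_le_hasSum _ (fun n _ => mul_nonneg (PowerSeries.coeff_mk_pow_nonneg
      (reducedTaylorNorm_nonneg fun x => (φ x : ℂ)) k n) (by positivity)) h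
  · exact hfsum.of_nonneg_of_le (fun k => mul_nonneg (taylorNorm_nonneg f k) (by positivity))
      fun k => mul_le_mul_of_nonneg_left (pow_le_pow_left₀ hβ0 hβs k) (taylorNorm_nonneg f k)

/-! ### Growth of the weights and the geometric gain -/

theorem IsNonanalytic.exists_le_mul_pow (hM : IsWeightSequence M) (hna : IsNonanalytic M) {δ : ℝ}
    (hδ : 0 < δ) : ∃ C : ℝ, 0 ≤ C ∧ ∀ n : ℕ, (n.factorial : ℝ) / M n ≤ C * δ ^ n := by
  have h0 : ∀ n : ℕ, 0 ≤ (n.factorial : ℝ) / M n :=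
    fun n => div_nonneg (Nat.cast_nonneg _) (hM.pos n).le
  obtain ⟨N, hN⟩ := eventually_atTop.1 (hna.eventually (eventually_le_nhds hδ))
  set S := ∑ n ∈ Finset.range (N + 1), (n.factorial : ℝ) / M n / δ ^ n with hS
  have hS0 : 0 ≤ S := Finset.sum_nonneg fun n _ => div_nonneg (h0 n) (by positivity)
  refine ⟨S + 1, by positivity, fun n => ?_⟩
  rcases Nat.lt_or_ge n (N + 1) with hn | hn
  · rw [← div_le_iff₀ (by positivity)]
    have : (n.factorial : ℝ) / M n / δ ^ n ≤ S :=
      Finset.single_le_sum (f := fun n : ℕ => (n.factorial : ℝ) / M n / δ ^ n)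
        (fun n _ => div_nonneg (h0 n) (by positivity)) (Finset.mem_range.2 hn)
    linarith
  · have hn0 : (n : ℝ) ≠ 0 := by
      have : n ≠ 0 := by omega
      exact_mod_cast this
    have h1 : (n.factorial : ℝ) / M n ≤ δ ^ n := by
      calc (n.factorial : ℝ) / M n = (((n.factorial : ℝ) / M n) ^ (1 / (n : ℝ))) ^ n := by
            rw [← Real.rpow_natCast, ← Real.rpow_mul (h0 n), one_div,
              inv_mul_cancel₀ hn0, Real.rpow_one]
        _ ≤ _ := pow_le_pow_left₀ (Real.rpow_nonneg (h0 n) _) (hN n (by omega)) n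
    refine h1.trans (le_mul_of_one_le_left (by positivity) (by linarith))

/-- The weight inequality, with the binomial coefficient written out, is submultiplicativity of `n!
/ M n`. -/
theorem IsWeightSequence.factorial_div_add_le (hM : IsWeightSequence M) (j k : ℕ) :
    ((j + k).factorial : ℝ) / M (j + k) ≤
      (j.factorial : ℝ) / M j * ((k.factorial : ℝ) / M k) := by
  have h := hM.choose_le j k
  have h1 := hM.pos j
  have h2 := hM.pos k
  have h3 := hM.pos (j + k)
  rw [Nat.cast_choose ℝ (Nat.le_add_left k j), Nat.add_sub_cancel] at h
  have h4 : (0 : ℝ) < j.factorial := by exact_mod_cast j.factorial_pos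
  have h5 : (0 : ℝ) < k.factorial := by exact_mod_cast k.factorial_pos
  rw [div_le_div_iff₀ (by positivity) (by positivity)] at h
  rw [div_mul_div_comm, div_le_div_iff₀ (by positivity) (by positivity)]
  linarith

theorem ddTerm_eq_mul_taylorNorm (M : ℕ → ℝ) (f : X → ℂ) (n : ℕ) :
    ddTerm M f n = (n.factorial : ℝ) / M n * taylorNorm f n := by
  have : (n.factorial : ℝ) ≠ 0 := by exact_mod_cast n.factorial_ne_zero
  unfold ddTerm taylorNorm
  field_simp

/-- Composition with an analytic contraction gains a geometric weight. -/
theorem exists_weighted_ddTerm_comp_le (hX : IsCompact X) (hP : Perfect X)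
    (hM : IsWeightSequence M) (hna : IsNonanalytic M)
    (hφ : HasTaylorRadius fun x => (φ x : ℂ)) (hφ1 : taylorNorm (fun x => (φ x : ℂ)) 1 < 1) :
    ∃ η C : ℝ, 1 < η ∧ ∀ f : X → ℂ, MemDD M f →
      Summable (fun n => η ^ n * ddTerm M (f ∘ φ) n) ∧
      ∑' n, η ^ n * ddTerm M (f ∘ φ) n ≤ C * ∑' n, ddTerm M f n := by
  obtain ⟨hφs, s, hs, hφsum⟩ := hφ
  have hφsum := summable_reducedTaylorNorm s hs.le hφsum
  set q := taylorNorm (fun x => (φ x : ℂ)) 1 with hq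
  have hq0 : 0 ≤ q := taylorNorm_nonneg _ _
  set S := ∑' n, reducedTaylorNorm (fun x => (φ x : ℂ)) n * s ^ n with hS
  have hS0 : 0 ≤ S := tsum_nonneg fun n => mul_nonneg (reducedTaylorNorm_nonneg _ n)
    (by positivity)
  have hq1 : 0 < 1 - q := by linarith
  -- This makes `t * S ≤ s * (1 - q) / 2`, whence `β ≤ q * t * s + t * s * (1 - q) / 2 = δ`,
  -- strictly below `t * s`.
  set t := min 1 (s * (1 - q) / 2 / (S + 1)) with ht
  have ht0 : 0 < t := lt_min one_pos (by positivity)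
  obtain ⟨hsum, -, hle⟩ := summable_reducedTaylorNorm_scale hs.le ht0.le (min_le_left _ _) hφsum
  set β := ∑' n, reducedTaylorNorm (fun x => (φ x : ℂ)) n * (t * s) ^ n with hβ
  have hβ0 : 0 ≤ β := tsum_nonneg fun n => mul_nonneg (reducedTaylorNorm_nonneg _ n)
    (by positivity)
  set δ := t * s * ((1 + q) / 2) with hδ
  have hδ0 : 0 < δ := by positivity
  have hβδ : β ≤ δ := by
    have h1 : t * S ≤ s * (1 - q) / 2 / (S + 1) * (S + 1) :=
      mul_le_mul (min_le_right _ _) (by linarith) hS0 (by positivity)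
    rw [div_mul_cancel₀ _ (by positivity)] at h1
    have h2 := mul_le_mul_of_nonneg_left h1 ht0.le
    nlinarith
  -- The gap between `δ` and `t * s` is spent on the gain: `η * δ = t * s`.
  set η := 2 / (1 + q) with hη
  have hη1 : 1 < η := by rw [hη, lt_div_iff₀ (by positivity)]; linarith
  have hηδ : η * δ = t * s := by rw [hη, hδ]; field_simp
  obtain ⟨C, hC0, hC⟩ := hna.exists_le_mul_pow hM hδ0
  have ha0 : ∀ n : ℕ, 0 ≤ (n.factorial : ℝ) / M n :=
    fun n => div_nonneg (Nat.cast_nonneg _) (hM.pos n).le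
  refine ⟨η, C, hη1, fun f hf => ?_⟩
  have hcn := PowerSeries.coeff_mk_pow_nonneg (reducedTaylorNorm_nonneg fun x => (φ x : ℂ))
  have hBv : (fun k : ℕ => taylorNorm f k * ((k.factorial : ℝ) / M k * C)) =
      fun k => C * ddTerm M f k := by
    funext k; rw [ddTerm_eq_mul_taylorNorm]; ring
  have := summable_weighted_of_triangular_le (taylorNorm_nonneg (f ∘ φ)) (taylorNorm_nonneg f)
    (w := fun n => η ^ n * ((n.factorial : ℝ) / M n))
    (v := fun k : ℕ => (k.factorial : ℝ) / M k * C)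
    (fun n => mul_nonneg (by positivity) (ha0 n)) (fun n k => hcn k n)
    (taylorNorm_comp_le hX hP hf.1 hφs) ?_ (by rw [hBv]; exact hf.2.mul_left C)
  · rw [hBv, tsum_mul_left] at this
    simpa only [ddTerm_eq_mul_taylorNorm M (f ∘ φ), mul_assoc] using this
  · intro k N
    have h := PowerSeries.hasSum_coeff_mk_pow hsum.hasSum k
    -- Terms with `n < k` vanish. For `n = j + k`, submultiplicativity and nonanalyticity bound `n!
    -- / M n` by `C * δ ^ j * (k! / M k)`, and `η ^ n * δ ^ j = (t * s) ^ n / δ ^ k`. Summing over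
    -- `n` leaves the factor `(β / δ) ^ k ≤ 1`.
    have hterm : ∀ n, η ^ n * ((n.factorial : ℝ) / M n) *
        PowerSeries.coeff n (PowerSeries.mk (reducedTaylorNorm fun x => (φ x : ℂ)) ^ k) ≤
        (k.factorial : ℝ) / M k * C * (1 / δ ^ k) *
        (PowerSeries.coeff n (PowerSeries.mk (reducedTaylorNorm fun x => (φ x : ℂ)) ^ k) *
          (t * s) ^ n) := by
      intro n
      rcases Nat.lt_or_ge n k with hn | hn
      · rw [PowerSeries.coeff_mk_pow_eq_zero (by simp [reducedTaylorNorm]) hn]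
        simp
      · obtain ⟨j, rfl⟩ := Nat.exists_eq_add_of_le' hn
        have h1 := hM.factorial_div_add_le j k
        have h2 := mul_le_mul_of_nonneg_right (hC j) (ha0 k)
        have h3 := mul_le_mul_of_nonneg_left (h1.trans h2)
          (by positivity : 0 ≤ η ^ (j + k))
        refine (mul_le_mul_of_nonneg_right h3 (hcn k (j + k))).trans (le_of_eq ?_)
        rw [← hηδ, mul_pow η δ, pow_add δ]
        field_simp
    refine (Finset.sum_le_sum fun n _ => hterm n).trans ?_
    rw [← Finset.mul_sum]
    have h4 := sum_le_hasSum (Finset.range N) (fun n _ => mul_nonneg (hcn k n) (by positivity)) h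
    have h5 : (1 / δ ^ k) * β ^ k ≤ 1 := by
      rw [one_div, inv_mul_le_iff₀ (by positivity), mul_one]
      exact pow_le_pow_left₀ hβ0 hβδ k
    have h6 : 0 ≤ (k.factorial : ℝ) / M k * C := mul_nonneg (ha0 k) hC0
    calc _ ≤ (k.factorial : ℝ) / M k * C * (1 / δ ^ k) * β ^ k :=
          mul_le_mul_of_nonneg_left h4 (mul_nonneg h6 (by positivity))
      _ = (k.factorial : ℝ) / M k * C * ((1 / δ ^ k) * β ^ k) := by ring
      _ ≤ _ := mul_le_of_le_one_right h6 h5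

end Taylor

/-! ### Compactness -/

namespace DalesDavie

variable {X : Set ℂ} {M : ℕ → ℝ} {hX : IsCompact X} {hP : Perfect X} {hM : IsWeightSequence M}

theorem ddTerm_le_norm (f : DalesDavie X M hX hP hM) (n : ℕ) : ddTerm M f.1 n ≤ ‖f‖ :=
  f.2.2.le_tsum n fun k _ => ddTerm_nonneg hM _ k

theorem norm_relDeriv_le (f : DalesDavie X M hX hP hM) (n : ℕ) (x : X) :
    ‖relDeriv n f.1 x‖ ≤ M n * ‖f‖ := by
  have h := ddTerm_le_norm f n
  rw [ddTerm, div_le_iff₀ (hM.pos n)] at h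
  rw [mul_comm]
  exact (norm_le_unifNorm hX (f.2.1.continuous_relDeriv n) x).trans h

theorem relDeriv_add (f g : DalesDavie X M hX hP hM) (n : ℕ) (x : X) :
    relDeriv n (f + g).1 x = relDeriv n f.1 x + relDeriv n g.1 x := by
  change relDeriv n (f.1 + g.1) x = _
  simp only [relDeriv, planeExt_add]
  exact iteratedDerivWithin_add x.2 hP.uniqueDiffOn_plane
    (f.2.1.contDiffWithinAt hP n x) (g.2.1.contDiffWithinAt hP n x)

theorem relDeriv_smul (c : ℂ) (f : DalesDavie X M hX hP hM) (n : ℕ) (x : X) :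
    relDeriv n (c • f).1 x = c * relDeriv n f.1 x := by
  change relDeriv n (c • f.1) x = _
  simp [relDeriv, planeExt_smul]

/-- The bounded functional `f ↦ f^(n)(x)`. -/
noncomputable def evalDeriv (n : ℕ) (x : X) : DalesDavie X M hX hP hM →L[ℂ] ℂ :=
  LinearMap.mkContinuous
    { toFun := fun f => relDeriv n f.1 x
      map_add' := fun f g => relDeriv_add f g n x
      map_smul' := fun c f => relDeriv_smul c f n x } (M n) fun f => norm_relDeriv_le f n x

theorem evalDeriv_apply (n : ℕ) (x : X) (f : DalesDavie X M hX hP hM) :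
    evalDeriv n x f = relDeriv n f.1 x := rfl

/-- Near `z` differentiability bounds the difference quotient; away from `z` the denominator is
bounded below. This is the pointwise hypothesis for uniform boundedness. -/
theorem exists_norm_relDeriv_sub_le_of_mem (f : DalesDavie X M hX hP hM) (n : ℕ) (z : X) :
    ∃ C : ℝ, ∀ w : X, ‖((w : ℂ) - z)⁻¹ * (relDeriv n f.1 w - relDeriv n f.1 z)‖ ≤ C := by
  obtain ⟨C, hC⟩ := ((f.2.1 n) z z.2).isBigO_sub.bound
  obtain ⟨r, hr, hball⟩ := Metric.mem_nhdsWithin_iff.1 hC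
  refine ⟨max |C| (r⁻¹ * (2 * (M n * ‖f‖))), fun w => ?_⟩
  rw [norm_mul, norm_inv]
  by_cases hw : (w : ℂ) ∈ Metric.ball (z : ℂ) r
  · have h : ‖relDeriv n f.1 w - relDeriv n f.1 z‖ ≤ C * ‖(w : ℂ) - z‖ := hball ⟨hw, w.2⟩
    refine le_max_of_le_left ?_
    rcases (norm_nonneg ((w : ℂ) - z)).eq_or_lt with h0 | h0
    · rw [← h0]; simp
    · rw [inv_mul_le_iff₀ h0, mul_comm]
      exact h.trans (mul_le_mul_of_nonneg_right (le_abs_self C) h0.le)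
  · refine le_max_of_le_right ?_
    have h1 : r ≤ ‖(w : ℂ) - z‖ := by simpa [dist_eq_norm] using hw
    refine mul_le_mul (inv_anti₀ hr h1) ?_ (norm_nonneg _) (by positivity)
    refine (norm_sub_le _ _).trans ?_
    linarith [norm_relDeriv_le f n w, norm_relDeriv_le f n z]

/-- Banach–Steinhaus for the difference quotient functionals at `z`. This replaces a mean value
inequality, since no control on paths in `X` is assumed. -/
theorem exists_norm_relDeriv_sub_le [CompleteSpace (DalesDavie X M hX hP hM)] (n : ℕ) (z : X) :
    ∃ C : ℝ, ∀ (w : X) (f : DalesDavie X M hX hP hM),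
      ‖relDeriv n f.1 w - relDeriv n f.1 z‖ ≤ C * ‖f‖ * ‖(w : ℂ) - z‖ := by
  obtain ⟨C, hC⟩ := banach_steinhaus
    (g := fun w : X => ((w : ℂ) - z)⁻¹ •
      (evalDeriv n w - evalDeriv n z : DalesDavie X M hX hP hM →L[ℂ] ℂ))
    (fun f => exists_norm_relDeriv_sub_le_of_mem f n z)
  refine ⟨C, fun w f => ?_⟩
  have h := ContinuousLinearMap.le_of_opNorm_le _ (hC w) f
  change ‖((w : ℂ) - z)⁻¹ * (relDeriv n f.1 w - relDeriv n f.1 z)‖ ≤ C * ‖f‖ at h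
  rcases eq_or_ne (w : ℂ) z with h0 | h0
  · rw [Subtype.ext h0]; simp
  · rw [norm_mul, norm_inv, inv_mul_le_iff₀ (norm_pos_iff.2 (sub_ne_zero.2 h0))] at h
    linarith

/-- The `n`-th derivative of an element of `D(X, M)` as a bounded continuous function. -/
noncomputable def derivBCF (n : ℕ) (f : DalesDavie X M hX hP hM) :
    BoundedContinuousFunction X ℂ :=
  BoundedContinuousFunction.ofNormedAddCommGroup (relDeriv n f.1) (f.2.1.continuous_relDeriv n)
    (M n * ‖f‖) (norm_relDeriv_le f n)

/-- Arzelà–Ascoli: the Lipschitz estimate at each point, uniform over bounded sets, supplies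
equicontinuity. -/
theorem totallyBounded_image_derivBCF [CompleteSpace (DalesDavie X M hX hP hM)] (n : ℕ) {R : ℝ}
    {S : Set (DalesDavie X M hX hP hM)} (hS : ∀ f ∈ S, ‖f‖ ≤ R) :
    TotallyBounded (derivBCF n '' S) := by
  have : CompactSpace X := isCompact_iff_compactSpace.1 hX
  refine (BoundedContinuousFunction.arzela_ascoli (Metric.closedBall (0 : ℂ) (M n * R))
    (isCompact_closedBall _ _) _ ?_ ?_).totallyBounded.subset subset_closure
  · rintro _ x ⟨f, hf, rfl⟩
    rw [mem_closedBall_zero_iff]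
    exact (norm_relDeriv_le f n x).trans (mul_le_mul_of_nonneg_left (hS f hf) (hM.pos n).le)
  · intro z
    obtain ⟨C, hC⟩ := exists_norm_relDeriv_sub_le (hX := hX) (hP := hP) (hM := hM) n z
    rw [Metric.equicontinuousAt_iff_right]
    intro ε hε
    have hcont : Tendsto (fun w : X => |C| * |R| * ‖(w : ℂ) - z‖) (𝓝 z) (𝓝 0) := by
      have : Continuous fun w : X => |C| * |R| * ‖(w : ℂ) - z‖ := by fun_prop
      simpa using this.tendsto z
    filter_upwards [hcont.eventually (gt_mem_nhds hε)] with w hw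
    rintro ⟨_, f, hf, rfl⟩
    rw [dist_comm, dist_eq_norm]
    refine lt_of_le_of_lt ((hC w f).trans (mul_le_mul_of_nonneg_right ?_ (norm_nonneg _))) hw
    exact mul_le_mul (le_abs_self C) ((hS f hf).trans (le_abs_self R)) (norm_nonneg _)
      (abs_nonneg C)

theorem relDeriv_sub (f g : DalesDavie X M hX hP hM) (n : ℕ) (x : X) :
    relDeriv n (f - g).1 x = relDeriv n f.1 x - relDeriv n g.1 x :=
  map_sub (evalDeriv n x) f g

theorem ddTerm_sub_le (f g : DalesDavie X M hX hP hM) (n : ℕ) :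
    ddTerm M (f - g).1 n ≤ dist (derivBCF n f) (derivBCF n g) / M n := by
  refine div_le_div_of_nonneg_right (unifNorm_le dist_nonneg fun x => ?_) (hM.pos n).le
  rw [relDeriv_sub, ← dist_eq_norm]
  exact BoundedContinuousFunction.dist_coe_le_dist (f := derivBCF n f) (g := derivBCF n g) x

/-- From index `L` on, inserting the weight `η ^ n` costs at most the factor `η⁻¹ ^ L`. -/
theorem norm_le_sum_add_of_weighted {f : DalesDavie X M hX hP hM} {η K : ℝ} (hη : 1 < η)
    (hs : Summable fun n => η ^ n * ddTerm M f.1 n) (hK : ∑' n, η ^ n * ddTerm M f.1 n ≤ K)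
    (L : ℕ) : ‖f‖ ≤ ∑ n ∈ Finset.range L, ddTerm M f.1 n + (η⁻¹) ^ L * K := by
  have hη0 : 0 < η := by linarith
  have h0 : ∀ n, 0 ≤ ddTerm M f.1 n := ddTerm_nonneg hM f.1
  have htail : ∑' n, ddTerm M f.1 (n + L) ≤ (η⁻¹) ^ L * K := by
    refine le_trans ?_ (mul_le_mul_of_nonneg_left hK (by positivity))
    have h1 : ∀ n, ddTerm M f.1 (n + L) ≤
        (η⁻¹) ^ L * (η ^ (n + L) * ddTerm M f.1 (n + L)) := by
      intro n
      rw [← mul_assoc, pow_add, mul_comm (η ^ n), ← mul_assoc, ← mul_pow,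
        inv_mul_cancel₀ hη0.ne', one_pow, one_mul]
      exact le_mul_of_one_le_left (h0 _) (one_le_pow₀ hη.le)
    have h2 := (summable_nat_add_iff L).2 hs
    refine (((summable_nat_add_iff L).2 f.2.2).tsum_le_tsum h1 (h2.mul_left _)).trans ?_
    rw [tsum_mul_left]
    refine mul_le_mul_of_nonneg_left ?_ (by positivity)
    rw [← hs.sum_add_tsum_nat_add L]
    exact le_add_of_nonneg_left (Finset.sum_nonneg fun n _ => mul_nonneg (by positivity) (h0 n))
  calc ‖f‖ = ∑' n, ddTerm M f.1 n := rfl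
    _ = ∑ n ∈ Finset.range L, ddTerm M f.1 n + ∑' n, ddTerm M f.1 (n + L) :=
      (f.2.2.sum_add_tsum_nat_add L).symm
    _ ≤ _ := by linarith

/-- Every ultrafilter on the image of the unit ball is Cauchy: finitely many derivatives are made
uniformly close by total boundedness, and the weighted bound controls the tail. -/
theorem isCompactOperator_of_weighted [CompleteSpace (DalesDavie X M hX hP hM)]
    (T : DalesDavie X M hX hP hM →L[ℂ] DalesDavie X M hX hP hM) {η C : ℝ} (hη : 1 < η)
    (h : ∀ f, Summable (fun n => η ^ n * ddTerm M (T f).1 n) ∧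
      ∑' n, η ^ n * ddTerm M (T f).1 n ≤ C * ‖f‖) : IsCompactOperator T := by
  refine (isCompactOperator_iff_isCompact_closure_image_closedBall 
    (T : DalesDavie X M hX hP hM →ₗ[ℂ] DalesDavie X M hX hP hM) one_pos).2 ?_
  refine TotallyBounded.isCompact_of_isClosed (TotallyBounded.closure ?_) isClosed_closure
  set S : Set (DalesDavie X M hX hP hM) := T '' Metric.closedBall 0 1 with hSdef
  change TotallyBounded S
  have hS : ∀ f ∈ S, ‖f‖ ≤ ‖T‖ := by
    rintro _ ⟨g, hg, rfl⟩
    exact T.unit_le_opNorm g (mem_closedBall_zero_iff.1 hg)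
  rw [totallyBounded_iff_ultrafilter]
  intro U hU
  refine Metric.cauchy_iff.2 ⟨U.neBot, fun ε hε => ?_⟩
  -- The factor `2` bounds the norm of a difference of two points of the unit ball, to which the
  -- weighted estimate is applied.
  obtain ⟨L, hL⟩ : ∃ L : ℕ, (η⁻¹) ^ L * (|C| * 2) < ε / 2 := by
    have ht := (tendsto_pow_atTop_nhds_zero_of_lt_one (inv_nonneg.2 (by linarith : (0 : ℝ) ≤ η))
      (inv_lt_one_of_one_lt₀ hη)).mul_const (|C| * 2)
    rw [zero_mul] at ht
    exact (ht.eventually (gt_mem_nhds (half_pos hε))).exists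
  have hk : ∀ n : ℕ, ∃ t ∈ (U : Filter (DalesDavie X M hX hP hM)), ∀ f ∈ t, ∀ g ∈ t,
      dist (derivBCF n f) (derivBCF n g) < M n * (ε / 2 / (L + 1)) := by
    intro n
    have hc : Cauchy (Filter.map (derivBCF n) (U : Filter (DalesDavie X M hX hP hM))) :=
      totallyBounded_iff_ultrafilter.1 (totallyBounded_image_derivBCF n hS) (U.map (derivBCF n))
        (le_principal_iff.2 (image_mem_map (le_principal_iff.1 hU)))
    obtain ⟨t, ht, h'⟩ := (Metric.cauchy_iff.1 hc).2 (M n * (ε / 2 / (L + 1)))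
      (mul_pos (hM.pos n) (by positivity))
    exact ⟨_, ht, fun f hf g hg => h' _ hf _ hg⟩
  choose t htU ht using hk
  refine ⟨(⋂ n ∈ Finset.range L, t n) ∩ S,
    inter_mem ((biInter_finset_mem _).2 fun n _ => htU n) (le_principal_iff.1 hU), ?_⟩
  rintro f ⟨hft, a, ha, rfl⟩ g ⟨hgt, b, hb, rfl⟩
  rw [mem_closedBall_zero_iff] at ha hb
  obtain ⟨h1, h2⟩ := h (a - b)
  have hab : ‖a - b‖ ≤ 2 := (norm_sub_le _ _).trans (by linarith)
  have h3 : C * ‖a - b‖ ≤ |C| * 2 :=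
    mul_le_mul (le_abs_self C) hab (norm_nonneg _) (abs_nonneg C)
  have h4 := norm_le_sum_add_of_weighted hη h1 (h2.trans h3) L
  have h5 : ∑ n ∈ Finset.range L, ddTerm M (T (a - b)).1 n ≤ ε / 2 := by
    calc _ ≤ ∑ n ∈ Finset.range L, ε / 2 / (L + 1) := by
          refine Finset.sum_le_sum fun n hn => ?_
          rw [map_sub]
          refine (ddTerm_sub_le _ _ n).trans ?_
          rw [div_le_iff₀ (hM.pos n), mul_comm]
          exact (ht n _ (mem_iInter₂.1 hft n hn) _ (mem_iInter₂.1 hgt n hn)).le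
      _ = L / (L + 1) * (ε / 2) := by
          rw [Finset.sum_const, Finset.card_range, nsmul_eq_mul]; ring
      _ ≤ ε / 2 := mul_le_of_le_one_left (by positivity)
          ((div_le_one (by positivity)).2 (by linarith))
  rw [dist_eq_norm, ← map_sub]
  linarith

end DalesDavie

/-! ### Invariant closed subspaces without large spectrum -/

/-- The spectral radius is strictly below one, so Gelfand's formula gives eventual geometric decay
of `‖a ^ n‖`. -/
theorem tendsto_pow_zero_of_spectrum_lt_one {A : Type*} [NormedRing A] [NormedAlgebra ℂ A]
    [CompleteSpace A] (a : A) (h : ∀ c ∈ spectrum ℂ a, ‖c‖ < 1) :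
    Tendsto (fun n => a ^ n) atTop (𝓝 0) := by
  rcases subsingleton_or_nontrivial A with _ | _
  · simp [Subsingleton.elim _ (0 : A)]
  have hr : spectralRadius ℂ a < ((1 : NNReal) : ENNReal) :=
    spectrum.spectralRadius_lt_of_forall_lt a fun c hc => by exact_mod_cast h c hc
  obtain ⟨q, hq1, hq2⟩ := ENNReal.lt_iff_exists_nnreal_btwn.1 hr
  have hq : (q : ℝ) < 1 := by exact_mod_cast hq2
  have hev := (spectrum.pow_nnnorm_pow_one_div_tendsto_nhds_spectralRadius a).eventually
    (gt_mem_nhds hq1)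
  refine squeeze_zero_norm' ?_ (tendsto_pow_atTop_nhds_zero_of_lt_one q.2 hq)
  filter_upwards [hev, eventually_ge_atTop 1] with n hn hn1
  have hn0 : (n : ℝ) ≠ 0 := by positivity
  have h1 : (‖a ^ n‖₊ : ENNReal) ≤ (q : ENNReal) ^ n := by
    calc (‖a ^ n‖₊ : ENNReal) = ((‖a ^ n‖₊ : ENNReal) ^ (1 / n : ℝ)) ^ n := by
          rw [← ENNReal.rpow_natCast, ← ENNReal.rpow_mul, one_div, inv_mul_cancel₀ hn0,
            ENNReal.rpow_one]
      _ ≤ _ := by gcongr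
  exact_mod_cast h1

/-- The closed subspace `R` is a Banach space on which `c - T` is bijective, hence invertible, for
`1 ≤ ‖c‖`; so the restriction of `T` to `R` has spectrum in the open unit disc. -/
theorem tendsto_pow_apply_of_invariant {E : Type*} [NormedAddCommGroup E] [NormedSpace ℂ E]
    [CompleteSpace E] (T : E →L[ℂ] E) (R : Submodule ℂ E) (hR : IsClosed (R : Set E))
    (hTR : ∀ y ∈ R, T y ∈ R)
    (hsurj : ∀ c : ℂ, 1 ≤ ‖c‖ → ∀ y ∈ R, ∃ x ∈ R, c • x - T x = y)
    (hinj : ∀ c : ℂ, 1 ≤ ‖c‖ → ∀ x ∈ R, c • x - T x = 0 → x = 0) {y : E} (hy : y ∈ R) :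
    Tendsto (fun n => (T ^ n) y) atTop (𝓝 0) := by
  have : CompleteSpace R := hR.completeSpace_coe
  set S : R →L[ℂ] R := (T.comp R.subtypeL).codRestrict R fun x => hTR x x.2 with hS
  have hSapp : ∀ x : R, ((S x : R) : E) = T x := fun x => rfl
  have hpow : ∀ (n : ℕ) (x : R), (((S ^ n) x : R) : E) = (T ^ n) x := by
    intro n
    induction n with
    | zero => intro x; rfl
    | succ n ih =>
      intro x
      rw [pow_succ, pow_succ, mul_apply_eq_comp, mul_apply_eq_comp, ih,
        hSapp]
  have hspec : ∀ c ∈ spectrum ℂ S, ‖c‖ < 1 := by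
    intro c hc
    by_contra! h1
    refine hc (ContinuousLinearMap.isUnit_iff_bijective.2 ⟨?_, ?_⟩)
    · refine (injective_iff_map_eq_zero _).2 fun x hx => Subtype.ext (hinj c h1 x x.2 ?_)
      exact congrArg Subtype.val hx
    · intro y
      obtain ⟨x, hx, hxy⟩ := hsurj c h1 y y.2
      exact ⟨⟨x, hx⟩, Subtype.ext hxy⟩
  have ht := (tendsto_pow_zero_of_spectrum_lt_one S hspec)
  have ht2 : Tendsto (fun n => (S ^ n) ⟨y, hy⟩) atTop (𝓝 0) := by
    have h := ((ContinuousLinearMap.apply ℂ R (⟨y, hy⟩ : R)).continuous.tendsto 0).comp ht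
    rwa [map_zero] at h
  have ht3 := (continuous_subtype_val.tendsto (0 : R)).comp ht2
  exact ht3.congr fun n => hpow n ⟨y, hy⟩

namespace DalesDavie

variable {X : Set ℂ} {M : ℕ → ℝ} {hX : IsCompact X} {hP : Perfect X} {hM : IsWeightSequence M}

/-! ### The coordinate function -/

theorem relDeriv_coord (hP : Perfect X) (n : ℕ) (x : X) :
    relDeriv n (fun x : X => (x : ℂ)) x = if n = 0 then (x : ℂ) else if n = 1 then 1 else 0 := by
  have h : EqOn (planeExt fun x : X => (x : ℂ)) id X :=
    fun z hz => planeExt_coe (fun x : X => (x : ℂ)) ⟨z, hz⟩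
  rw [relDeriv, iteratedDerivWithin_congr h x.2, iteratedDerivWithin_id x.2 hP.uniqueDiffOn_plane]

theorem memDD_coord (hP : Perfect X) : MemDD M fun x : X => (x : ℂ) := by
  refine ⟨?_, summable_of_ne_finset_zero (s := Finset.range 2) fun n hn => ?_⟩
  · rw [isSmoothOn_iff hP]
    exact contDiffOn_id.congr fun z hz => planeExt_coe (fun x : X => (x : ℂ)) ⟨z, hz⟩
  · have hn : 2 ≤ n := not_lt.1 fun h => hn (Finset.mem_range.2 h)
    have h0 : ∀ x, relDeriv n (fun x : X => (x : ℂ)) x = 0 := fun x => by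
      rw [relDeriv_coord hP, if_neg (by omega), if_neg (by omega)]
    simp [ddTerm, unifNorm, h0]

/-- The coordinate function `z`. -/
def coord (hX : IsCompact X) (hP : Perfect X) (hM : IsWeightSequence M) :
    DalesDavie X M hX hP hM := ⟨fun x => (x : ℂ), memDD_coord hP⟩

theorem norm_apply_le (f : DalesDavie X M hX hP hM) (x : X) : ‖f x‖ ≤ ‖f‖ := by
  have h := norm_relDeriv_le f 0 x
  rwa [hM.zero, one_mul, relDeriv, iteratedDerivWithin_zero, planeExt_coe] at h

theorem ext_apply {f g : DalesDavie X M hX hP hM} (h : ∀ x, f x = g x) : f = g :=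
  Subtype.ext (funext h)

theorem continuous_coe (f : DalesDavie X M hX hP hM) : Continuous f.1 := by
  have h := f.2.1.continuous_relDeriv 0
  have h2 : relDeriv 0 f.1 = f.1 := by
    funext x
    rw [relDeriv, iteratedDerivWithin_zero, planeExt_coe]
  rwa [h2] at h

theorem smul_apply (c : ℂ) (f : DalesDavie X M hX hP hM) (x : X) : (c • f) x = c * f x := rfl

theorem sub_apply (f g : DalesDavie X M hX hP hM) (x : X) : (f - g) x = f x - g x := rfl

theorem pow_apply (f : DalesDavie X M hX hP hM) (n : ℕ) (x : X) : (f ^ n) x = f x ^ n :=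
  map_pow (eval x) f n

theorem one_apply (x : X) : (1 : DalesDavie X M hX hP hM) x = 1 := rfl

/-- The values lie in the finite root set of `p`, and a finite connected image is a point. -/
theorem eq_smul_one_of_polynomial (hconn : IsConnected X) (f : DalesDavie X M hX hP hM)
    {p : Polynomial ℂ} (hp : p ≠ 0) (h : ∀ x, p.eval (f x) = 0) :
    ∃ c : ℂ, f = c • (1 : DalesDavie X M hX hP hM) := by
  have : ConnectedSpace X := isConnected_iff_connectedSpace.1 hconn
  have hfin : (range f.1).Finite := by
    refine (p.roots.toFinset.finite_toSet).subset ?_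
    rintro _ ⟨x, rfl⟩
    simpa [hp] using h x
  have hsub : (range f.1).Subsingleton :=
    hfin.countable.isTotallyDisconnected _ Subset.rfl (isPreconnected_range (continuous_coe f))
  obtain ⟨x0⟩ := (inferInstance : Nonempty X)
  refine ⟨f x0, ext_apply fun x => ?_⟩
  rw [smul_apply, one_apply, mul_one]
  exact hsub ⟨x, rfl⟩ ⟨x0, rfl⟩

/-! ### Riesz endomorphisms -/

section Riesz

variable {φ : X → X} {T : DalesDavie X M hX hP hM →L[ℂ] DalesDavie X M hX hP hM}

theorem pow_apply_eq_iterate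
    (hTφ : ∀ (f : DalesDavie X M hX hP hM) (x : X), (T f) x = f (φ x)) (n : ℕ)
    (f : DalesDavie X M hX hP hM) (x : X) : ((T ^ n) f) x = f (φ^[n] x) := by
  induction n generalizing x with
  | zero => rfl
  | succ n ih =>
    rw [pow_succ', mul_apply_eq_comp, hTφ, ih, Function.iterate_succ_apply]

/-- The fixed functions form a subalgebra coinciding with the finite-dimensional kernel of `1 - T`,
so each is integral over `ℂ`. -/
theorem eq_smul_one_of_fixed (hconn : IsConnected X)
    (hTφ : ∀ (f : DalesDavie X M hX hP hM) (x : X), (T f) x = f (φ x))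
    (hT : IsRieszOperator T) {f : DalesDavie X M hX hP hM} (hf : T f = f) :
    ∃ c : ℂ, f = c • (1 : DalesDavie X M hX hP hM) := by
  have hfin := hT.finite_ker 1 one_ne_zero
  set K := (algebraMap ℂ (Module.End ℂ (DalesDavie X M hX hP hM)) 1 -
    (T : Module.End ℂ (DalesDavie X M hX hP hM))).ker with hK
  let A : Subalgebra ℂ (DalesDavie X M hX hP hM) :=
    { carrier := {g | T g = g}
      mul_mem' := fun {a b} ha hb => ext_apply fun x => by
        have h1 : a (φ x) = a x := by rw [← hTφ, show T a = a from ha]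
        have h2 : b (φ x) = b x := by rw [← hTφ, show T b = b from hb]
        rw [hTφ]
        exact congrArg₂ (· * ·) h1 h2
      add_mem' := fun {a b} ha hb => by
        change T (a + b) = a + b
        rw [map_add, show T a = a from ha, show T b = b from hb]
      algebraMap_mem' := fun c => ext_apply fun x => by rw [hTφ]; rfl }
  have hAK : Subalgebra.toSubmodule A = K := by
    ext g
    rw [hK, LinearMap.mem_ker, Subalgebra.mem_toSubmodule]
    change T g = g ↔ (1 : ℂ) • g - T g = 0
    rw [one_smul, sub_eq_zero, eq_comm]
  have : FiniteDimensional ℂ (Subalgebra.toSubmodule A) := hAK ▸ hfin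
  have : Module.Finite ℂ A := this
  obtain ⟨p, hp, hpf⟩ := IsIntegral.of_finite ℂ (⟨f, hf⟩ : A)
  refine eq_smul_one_of_polynomial hconn f hp.ne_zero fun x => ?_
  have h := congrArg (((eval x).comp A.val : A →ₐ[ℂ] ℂ)) hpf
  rw [← Polynomial.aeval_def, ← Polynomial.aeval_algHom_apply, map_zero] at h
  exact h

theorem mem_spectrum_of_eigenvector [CompleteSpace (DalesDavie X M hX hP hM)] {c : ℂ} {f : DalesDavie X M hX hP hM} (hf : f ≠ 0)
    (h : T f = c • f) : c ∈ spectrum ℂ T := by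
  intro hu
  refine hf ((ContinuousLinearMap.isUnit_iff_bijective.1 hu).1 ?_)
  rw [map_zero]
  change c • f - T f = 0
  rw [h, sub_self]

theorem finite_spectrum_one_le (hT : IsRieszOperator T) :
    {c ∈ spectrum ℂ T | 1 ≤ ‖c‖}.Finite := by
  have hsub : {c ∈ spectrum ℂ T | 1 ≤ ‖c‖} ⊆ spectrum ℂ T \ {0} := by
    rintro c ⟨hc, hc1⟩
    refine ⟨hc, ?_⟩
    rintro rfl
    rw [norm_zero] at hc1
    linarith
  by_cases hinf : (spectrum ℂ T \ {0}).Infinite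
  · obtain ⟨u, -, hu, hu0⟩ := hT.tendsto_zero hinf
    obtain ⟨N, hN⟩ := eventually_atTop.1 (hu0.norm.eventually
      (gt_mem_nhds (by rw [norm_zero]; exact one_pos : ‖(0 : ℂ)‖ < 1)))
    refine ((finite_Iio N).image u).subset fun c hc => ?_
    obtain ⟨n, rfl⟩ : c ∈ range u := hu ▸ hsub hc
    refine ⟨n, ?_, rfl⟩
    by_contra hn
    exact absurd (hN n (not_lt.1 hn)) (not_lt.2 hc.2)
  · exact (not_infinite.1 hinf).subset hsub

/-- Powers of an eigenfunction put all powers of `c` into a finite part of the spectrum, so `c ^ (m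
+ 1) = 1` for some `m`. Then `f ^ (m + 1)` is fixed, hence constant; so is `f`, and a nonzero
constant has eigenvalue `1`. -/
theorem eq_one_of_mem_spectrum [CompleteSpace (DalesDavie X M hX hP hM)] (hconn : IsConnected X)
    (hTφ : ∀ (f : DalesDavie X M hX hP hM) (x : X), (T f) x = f (φ x))
    (hT : IsRieszOperator T) {c : ℂ} (hc : c ∈ spectrum ℂ T) (hc1 : 1 ≤ ‖c‖) : c = 1 := by
  have hc0 : c ≠ 0 := by
    rintro rfl
    rw [norm_zero] at hc1
    linarith
  obtain ⟨f, hf⟩ := (hT.hasEigenvalue c hc hc0).exists_hasEigenvector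
  have hf0 : f ≠ 0 := hf.2
  have hfe : T f = c • f := hf.apply_eq_smul
  obtain ⟨x, hx⟩ : ∃ x, f x ≠ 0 := by
    by_contra! h
    exact hf0 (ext_apply h)
  have hmul : ∀ x, f (φ x) = c * f x := fun x => by rw [← hTφ, hfe]; rfl
  have hpow : ∀ n : ℕ, T (f ^ n) = c ^ n • f ^ n := fun n => ext_apply fun x => by
    rw [hTφ, pow_apply, hmul, smul_apply, pow_apply, mul_pow]
  have hfn : ∀ n : ℕ, f ^ n ≠ 0 := fun n h0 => by
    have := pow_apply f n x
    rw [h0] at this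
    exact pow_ne_zero n hx this.symm
  have hmem : ∀ n : ℕ, c ^ n ∈ {c ∈ spectrum ℂ T | 1 ≤ ‖c‖} := fun n =>
    ⟨mem_spectrum_of_eigenvector (hfn n) (hpow n), by rw [norm_pow]; exact one_le_pow₀ hc1⟩
  obtain ⟨a, b, hab, hcab⟩ : ∃ a b : ℕ, a < b ∧ c ^ a = c ^ b := by
    by_contra! h
    have hinj : Function.Injective fun n : ℕ => c ^ n := by
      intro a b hab
      rcases lt_trichotomy a b with h1 | h1 | h1
      · exact absurd hab (h a b h1)
      · exact h1
      · exact absurd hab.symm (h b a h1)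
    exact (infinite_range_of_injective hinj) ((finite_spectrum_one_le hT).subset
      (range_subset_iff.2 hmem))
  obtain ⟨m, rfl⟩ := Nat.exists_eq_add_of_lt hab
  have hcm : c ^ (m + 1) = 1 := by
    rw [add_assoc, pow_add] at hcab
    exact mul_left_cancel₀ (pow_ne_zero a hc0) (by rw [← hcab, mul_one])
  obtain ⟨d, hd⟩ := eq_smul_one_of_fixed hconn hTφ hT (f := f ^ (m + 1)) (by
    rw [hpow, hcm, one_smul])
  obtain ⟨e, he⟩ := eq_smul_one_of_polynomial hconn f
    (p := Polynomial.X ^ (m + 1) - Polynomial.C d)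
    (Polynomial.X_pow_sub_C_ne_zero (Nat.succ_pos m) d) (fun y => by
      have h1 := pow_apply f (m + 1) y
      rw [hd, smul_apply, one_apply, mul_one] at h1
      simp [← h1])
  have h1 := hmul x
  have h2 : ∀ y, f y = e := fun y => by rw [he, smul_apply, one_apply, mul_one]
  rw [h2, h2] at h1
  have he0 : e ≠ 0 := h2 x ▸ hx
  exact mul_right_cancel₀ he0 (by rw [← h1, one_mul])

/-- If `f - T f` is a constant `c`, then `f` drops by `c` at each step along an orbit, which
boundedness allows only for `c = 0`. Thus `ker (1 - T) ^ 2 = ker (1 - T)`. -/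
theorem sub_eq_zero_of_sub_fixed (hconn : IsConnected X)
    (hTφ : ∀ (f : DalesDavie X M hX hP hM) (x : X), (T f) x = f (φ x))
    (hT : IsRieszOperator T) {f : DalesDavie X M hX hP hM} (hf : T (f - T f) = f - T f) :
    f - T f = 0 := by
  obtain ⟨c, hc⟩ := eq_smul_one_of_fixed hconn hTφ hT hf
  have hstep : ∀ x, f (φ x) = f x - c := fun x => by
    have h1 : (f - T f) x = c := by rw [hc, smul_apply, one_apply, mul_one]
    rw [sub_apply, hTφ] at h1
    rw [← h1]; ring
  have hn : ∀ (n : ℕ) x, f (φ^[n] x) = f x - n * c := by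
    intro n
    induction n with
    | zero => intro x; simp
    | succ n ih =>
      intro x
      rw [Function.iterate_succ_apply', hstep, ih]
      push_cast; ring
  obtain ⟨x, hx⟩ := hconn.nonempty
  have hb : ∀ n : ℕ, n * ‖c‖ ≤ 2 * ‖f‖ := by
    intro n
    have h1 : (n : ℂ) * c = f ⟨x, hx⟩ - f (φ^[n] ⟨x, hx⟩) := by rw [hn]; ring
    calc n * ‖c‖ = ‖(n : ℂ) * c‖ := by simp
      _ ≤ ‖f ⟨x, hx⟩‖ + ‖f (φ^[n] ⟨x, hx⟩)‖ := by rw [h1]; exact norm_sub_le _ _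
      _ ≤ _ := by linarith [norm_apply_le f ⟨x, hx⟩, norm_apply_le f (φ^[n] ⟨x, hx⟩)]
  have hc0 : c = 0 := by
    by_contra h
    obtain ⟨n, hn⟩ := exists_nat_gt (2 * ‖f‖ / ‖c‖)
    rw [div_lt_iff₀ (norm_pos_iff.2 h)] at hn
    linarith [hb n]
  rw [hc, hc0, zero_smul]

theorem exists_tendsto_iterate [CompleteSpace (DalesDavie X M hX hP hM)] (hconn : IsConnected X)
    (hTφ : ∀ (f : DalesDavie X M hX hP hM) (x : X), (T f) x = f (φ x))
    (hT : IsRieszOperator T) :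
    ∃ k : ℂ, ∀ ε > 0, ∀ᶠ n in atTop, ∀ x : X, ‖(φ^[n] x : ℂ) - k‖ < ε := by
  set E := DalesDavie X M hX hP hM with hE
  set A : Module.End ℂ E := algebraMap ℂ (Module.End ℂ E) 1 - (T : Module.End ℂ E) with hA
  have hAapp : ∀ f, A f = f - T f := fun f => by
    change (1 : ℂ) • f - T f = _
    rw [one_smul]
  have hker : ∀ f, A (A f) = 0 → A f = 0 := by
    intro f hf
    rw [hAapp, hAapp, sub_eq_zero] at hf
    rw [hAapp]
    exact sub_eq_zero_of_sub_fixed hconn hTφ hT hf.symm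
  have hclosed : IsClosed (A.range : Set E) := by
    have h := hT.isClosed_range 1 one_ne_zero
    exact h
  -- The null chain has length at most one, hence so does the image chain, and `A` maps its range
  -- onto itself.
  have hrange : ∀ y ∈ A.range, ∃ x ∈ A.range, A x = y := by
    rintro _ ⟨w, rfl⟩
    obtain ⟨p, ⟨-, hp⟩, ⟨hp2, -⟩⟩ := hT.chains 1 one_ne_zero
    have hp1 : p ≤ 1 := hp (by
      ext f
      simp only [pow_succ, pow_zero, one_mul, LinearMap.mem_ker, Module.End.mul_apply]
      exact ⟨fun h => by rw [← hA, ← hA] at *; rw [h, map_zero], fun h => hker f h⟩)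
    have hp2' : (A ^ p).range = (A ^ (p + 1)).range := hp2
    interval_cases p
    · refine ⟨w, ?_, rfl⟩
      rw [pow_zero, zero_add, pow_one] at hp2'
      rw [← hp2']
      exact ⟨w, rfl⟩
    · have : A w ∈ (A ^ (1 + 1)).range := hp2' ▸ ⟨w, by rw [pow_one]⟩
      obtain ⟨v, hv⟩ := this
      rw [pow_succ, pow_one, Module.End.mul_apply] at hv
      exact ⟨A v, ⟨v, rfl⟩, hv⟩
  have hcomm : ∀ f, A (T f) = T (A f) := fun f => by rw [hAapp, hAapp, map_sub]
  have hbij : ∀ c : ℂ, 1 ≤ ‖c‖ → c ≠ 1 →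
      Function.Bijective (algebraMap ℂ (E →L[ℂ] E) c - T) := by
    intro c hc hc1
    refine ContinuousLinearMap.isUnit_iff_bijective.1 ?_
    by_contra h
    exact hc1 (eq_one_of_mem_spectrum hconn hTφ hT h hc)
  have hlim : ∀ y ∈ A.range, Tendsto (fun n => (T ^ n) y) atTop (𝓝 0) := by
    intro y hy
    refine tendsto_pow_apply_of_invariant T A.range hclosed ?_ ?_ ?_ hy
    · rintro _ ⟨w, rfl⟩
      exact ⟨T w, hcomm w⟩
    · intro c hc y hy
      by_cases hc1 : c = 1
      · obtain ⟨x, hx, hxy⟩ := hrange y hy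
        exact ⟨x, hx, by rw [hc1, one_smul, ← hAapp, hxy]⟩
      · obtain ⟨w, rfl⟩ := hy
        obtain ⟨v, rfl⟩ := (hbij c hc hc1).2 w
        refine ⟨A v, ⟨v, rfl⟩, ?_⟩
        change _ = A (c • v - T v)
        rw [map_sub, map_smul, hcomm]
    · rintro c hc _ ⟨w, rfl⟩ h0
      by_cases hc1 : c = 1
      · rw [hc1, one_smul, ← hAapp] at h0
        exact hker w h0
      · refine (hbij c hc hc1).1 ?_
        rw [map_zero]
        exact h0
  -- The coordinate function minus `x` is killed by `A`, so it is a constant `k`. Then `T ^ n x` is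
  -- the function `φ^[n] - k`, and it tends to zero in norm because `x` lies in the range.
  obtain ⟨x, hx, hxZ⟩ := hrange (A (coord hX hP hM)) ⟨_, rfl⟩
  have hfix : T (coord hX hP hM - x) = coord hX hP hM - x := by
    have h : A (coord hX hP hM - x) = 0 := by rw [map_sub, hxZ, sub_self]
    rw [hAapp, sub_eq_zero] at h
    exact h.symm
  obtain ⟨k, hk⟩ := eq_smul_one_of_fixed hconn hTφ hT hfix
  refine ⟨k, fun ε hε => ?_⟩
  have hx0 := (hlim x hx).norm
  rw [norm_zero] at hx0
  filter_upwards [hx0.eventually (gt_mem_nhds hε)] with n hn y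
  have h1 : (coord hX hP hM - x) (φ^[n] y) = k := by
    rw [hk, smul_apply, one_apply, mul_one]
  have h2 : (φ^[n] y : ℂ) - k = ((T ^ n) x) y := by
    rw [pow_apply_eq_iterate hTφ, ← h1, sub_apply]
    change (φ^[n] y : ℂ) - ((φ^[n] y : ℂ) - _) = _
    ring
  rw [h2]
  exact (norm_apply_le _ y).trans_lt hn

theorem relDeriv_one_comp_fixed {x0 : X} (hx0 : φ x0 = x0)
    (hφ : IsSmoothOn fun x => (φ x : ℂ))
    (hTφ : ∀ (f : DalesDavie X M hX hP hM) (x : X), (T f) x = f (φ x))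
    (f : DalesDavie X M hX hP hM) :
    relDeriv 1 (T f).1 x0 = relDeriv 1 (fun x => (φ x : ℂ)) x0 * relDeriv 1 f.1 x0 := by
  have h : (T f).1 = f.1 ∘ φ := funext (hTφ f)
  rw [h, relDeriv_comp_one hP f.2.1 hφ, hx0, mul_comm]

/-- By the chain rule `f ↦ f'(x0)` is an eigenvector of the adjoint of `T` for `c = φ'(x0)`. It is
nonzero on the coordinate function, so `c` is in the spectrum, and `1 ≤ ‖c‖` would force `c = 1`.
Then value and derivative at `x0` both vanish on the range of `1 - T`, whose codimension is at least
two, whereas the kernel contains only constants. -/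
theorem norm_relDeriv_one_fixed_lt_one [CompleteSpace (DalesDavie X M hX hP hM)]
    (hconn : IsConnected X) {x0 : X}
    (hx0 : φ x0 = x0) (hφ : IsSmoothOn fun x => (φ x : ℂ))
    (hTφ : ∀ (f : DalesDavie X M hX hP hM) (x : X), (T f) x = f (φ x))
    (hT : IsRieszOperator T) : ‖relDeriv 1 (fun x => (φ x : ℂ)) x0‖ < 1 := by
  set c := relDeriv 1 (fun x => (φ x : ℂ)) x0 with hc
  by_contra! h1
  set E := DalesDavie X M hX hP hM with hE
  have hD : ∀ f : E, evalDeriv 1 x0 (T f) = c * evalDeriv 1 x0 f :=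
    relDeriv_one_comp_fixed hx0 hφ hTφ
  have hZ : evalDeriv 1 x0 (coord hX hP hM) = 1 := by
    rw [evalDeriv_apply]
    exact (relDeriv_coord hP 1 x0).trans (by simp)
  have hspec : c ∈ spectrum ℂ T := by
    intro hu
    obtain ⟨f, hf⟩ := (ContinuousLinearMap.isUnit_iff_bijective.1 hu).2 (coord hX hP hM)
    have hf : c • f - T f = coord hX hP hM := hf
    have h2 := congrArg (evalDeriv 1 x0) hf
    rw [map_sub, map_smul, hD, hZ, smul_eq_mul, sub_self] at h2
    exact zero_ne_one h2
  have hc1 := eq_one_of_mem_spectrum hconn hTφ hT hspec h1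
  have hfr := hT.finrank_eq 1 one_ne_zero
  have hcok := hT.finite_coker 1 one_ne_zero
  set A : Module.End ℂ E := algebraMap ℂ (Module.End ℂ E) 1 - (T : Module.End ℂ E) with hA
  have hAapp : ∀ f, A f = f - T f := fun f => by
    change (1 : ℂ) • f - T f = _
    rw [one_smul]
  have hker : Module.finrank ℂ A.ker ≤ 1 := by
    have hle : A.ker ≤ Submodule.span ℂ {(1 : E)} := by
      intro f hf
      rw [LinearMap.mem_ker, hAapp, sub_eq_zero] at hf
      obtain ⟨d, hd⟩ := eq_smul_one_of_fixed hconn hTφ hT hf.symm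
      exact Submodule.mem_span_singleton.2 ⟨d, hd.symm⟩
    exact (Submodule.finrank_mono hle).trans
      ((finrank_span_le_card ({(1 : E)} : Set E)).trans (by simp))
  let Ψ : E →ₗ[ℂ] ℂ × ℂ := (eval x0).toLinearMap.prod (evalDeriv 1 x0 : E →L[ℂ] ℂ).toLinearMap
  have hΨ : A.range ≤ LinearMap.ker Ψ := by
    rintro _ ⟨f, rfl⟩
    rw [LinearMap.mem_ker, hAapp]
    refine Prod.ext ?_ ?_
    · change f x0 - (T f) x0 = 0
      rw [hTφ, hx0, sub_self]
    · change evalDeriv 1 x0 (f - T f) = 0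
      rw [map_sub, hD, hc1, one_mul, sub_self]
  have hone : evalDeriv 1 x0 (1 : E) = 0 := by
    have h2 : evalDeriv 1 x0 ((1 : E) ) = relDeriv 1 (fun _ : X => (1 : ℂ)) x0 := rfl
    rw [h2, relDeriv, iteratedDerivWithin_congr (planeExt_const (X := X) 1) x0.2,
      iteratedDerivWithin_const, if_neg one_ne_zero]
  have hsurj : Function.Surjective (A.range.liftQ Ψ hΨ) := by
    rintro ⟨a, b⟩
    -- The affine function `a + b (z - x0)` has value `a` and derivative `b` at `x0`.
    refine ⟨A.range.mkQ (a • (1 : E) + b • (coord hX hP hM - (x0 : ℂ) • (1 : E))), ?_⟩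
    rw [Submodule.mkQ_apply, Submodule.liftQ_apply]
    refine Prod.ext ?_ ?_
    · change a * 1 + b * ((x0 : ℂ) - x0 * 1) = a
      ring
    · change evalDeriv 1 x0 (a • (1 : E) + b • (coord hX hP hM - (x0 : ℂ) • (1 : E))) = b
      simp [hone, hZ]
  have h2 : Module.finrank ℂ (ℂ × ℂ) ≤ Module.finrank ℂ (E ⧸ A.range) :=
    LinearMap.finrank_le_finrank_of_surjective hsurj
  rw [Module.finrank_prod, Module.finrank_self] at h2
  exact absurd ((h2.trans hfr.ge).trans hker) (by norm_num)

end Riesz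

/-! ### Iterates of an analytic selfmap near an attracting fixed point -/

theorem hasTaylorRadius_iterate_succ (hX : IsCompact X) (hP : Perfect X) {φ : X → X}
    (hφ : HasTaylorRadius fun x => (φ x : ℂ)) (n : ℕ) :
    HasTaylorRadius fun x => (φ^[n + 1] x : ℂ) := by
  induction n with
  | zero => exact hφ
  | succ n ih =>
    have h := hφ.comp hX hP ih
    rw [show (fun x => (φ^[n + 1 + 1] x : ℂ)) = (fun x => (φ x : ℂ)) ∘ φ^[n + 1] from
      funext fun x => by rw [Function.iterate_succ_apply']; rfl]
    exact h

/-- Once an iterate maps all of `X` into a neighbourhood of `x0` where `‖φ'‖ < q < 1`, each further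
iteration multiplies the sup norm of the derivative by at most `q`. -/
theorem exists_taylorNorm_iterate_lt_one (hX : IsCompact X) (hP : Perfect X) {φ : X → X}
    (hφ : HasTaylorRadius fun x => (φ x : ℂ)) {x0 : X}
    (hlim : ∀ ε > 0, ∀ᶠ n in atTop, ∀ x : X, ‖(φ^[n] x : ℂ) - x0‖ < ε)
    (h1 : ‖relDeriv 1 (fun x => (φ x : ℂ)) x0‖ < 1) :
    ∃ n : ℕ, taylorNorm (fun x => (φ^[n + 1] x : ℂ)) 1 < 1 := by
  obtain ⟨q, hq1, hq2⟩ := exists_between h1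
  have hq0 : 0 ≤ q := (norm_nonneg _).trans hq1.le
  have hev := ((hφ.1.continuous_relDeriv 1).norm.tendsto x0).eventually (gt_mem_nhds hq1)
  obtain ⟨r, hr, hball⟩ := Metric.eventually_nhds_iff.1 hev
  obtain ⟨N, hN⟩ := eventually_atTop.1 (hlim r hr)
  set u : ℕ → ℝ := fun n => unifNorm (relDeriv 1 fun x => (φ^[n + 1] x : ℂ)) with hu
  have hstep : ∀ n, N ≤ n + 1 → u (n + 1) ≤ q * u n := by
    intro n hn
    refine unifNorm_le (mul_nonneg hq0 (unifNorm_nonneg _)) fun x => ?_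
    have hs := (hasTaylorRadius_iterate_succ hX hP hφ n).1
    have e : (fun x => (φ^[n + 1 + 1] x : ℂ)) = (fun x => (φ x : ℂ)) ∘ φ^[n + 1] :=
      funext fun x => by rw [Function.iterate_succ_apply']; rfl
    rw [e, relDeriv_comp_one hP hφ.1 hs, norm_mul]
    refine mul_le_mul (le_of_lt (hball ?_)) (norm_le_unifNorm hX (hs.continuous_relDeriv 1) x)
      (norm_nonneg _) hq0
    rw [Subtype.dist_eq, dist_eq_norm]
    exact hN (n + 1) hn x
  have hpow : ∀ m, u (N + m) ≤ q ^ m * u N := by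
    intro m
    induction m with
    | zero => simp
    | succ m ih =>
      calc u (N + m + 1) ≤ q * u (N + m) := hstep _ (by omega)
        _ ≤ q * (q ^ m * u N) := mul_le_mul_of_nonneg_left ih hq0
        _ = _ := by ring
  have ht := (tendsto_pow_atTop_nhds_zero_of_lt_one hq0 hq2).mul_const (u N)
  rw [zero_mul] at ht
  obtain ⟨m, hm⟩ := (ht.eventually (gt_mem_nhds one_pos)).exists
  refine ⟨N + m, ?_⟩
  rw [taylorNorm, Nat.factorial_one, Nat.cast_one, div_one]
  exact (hpow m).trans_lt hm

end DalesDavie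

/-! ### Power compactness of Riesz endomorphisms -/

theorem theorem2p3 (X : Set ℂ) (hX : IsCompact X) (hP : Perfect X) (hconn : IsConnected X)
    (M : ℕ → ℝ) (hM : IsWeightSequence M) (hna : IsNonanalytic M)
    (hBanach : CompleteSpace (DalesDavie X M hX hP hM))
    (hmax : DalesDavie.MaximalIdealSpaceIs X M hX hP hM)
    (φ : X → X) (hφ : IsAnalyticSelfmap φ)
    (T : DalesDavie X M hX hP hM →L[ℂ] DalesDavie X M hX hP hM)
    (hTmul : ∀ f g, T (f * g) = T f * T g)
    (hTφ : ∀ (f : DalesDavie X M hX hP hM) (x : X), (T f) x = f (φ x))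
    (hT : IsRieszOperator T) :
    IsPowerCompact T := by
  obtain ⟨k, hk⟩ := DalesDavie.exists_tendsto_iterate hconn hTφ hT
  obtain ⟨y, hy⟩ := hconn.nonempty
  have hlim : Tendsto (fun n => (φ^[n] ⟨y, hy⟩ : ℂ)) atTop (𝓝 k) := by
    rw [Metric.tendsto_atTop']
    intro ε hε
    obtain ⟨N, hN⟩ := eventually_atTop.1 (hk ε hε)
    exact ⟨N, fun n hn => by rw [dist_eq_norm]; exact hN n hn.le _⟩
  have hkX : k ∈ X := hX.isClosed.mem_of_tendsto hlim (Eventually.of_forall fun n => (φ^[n] _).2)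
  have hφc : Continuous φ := by
    refine continuous_induced_rng.2 ?_
    have h := hφ.1.continuous_relDeriv 0
    have h2 : relDeriv 0 (fun x => (φ x : ℂ)) = fun x => (φ x : ℂ) := by
      funext x
      rw [relDeriv, iteratedDerivWithin_zero, planeExt_coe]
    rw [h2] at h
    exact h
  -- A limit of an orbit of a continuous map is a fixed point.
  have hx0 : φ ⟨k, hkX⟩ = ⟨k, hkX⟩ :=
    isFixedPt_of_tendsto_iterate (tendsto_subtype_rng.2 hlim) hφc.continuousAt
  have h1 := DalesDavie.norm_relDeriv_one_fixed_lt_one hconn hx0 hφ.1 hTφ hT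
  have hrad := hφ.hasTaylorRadius
  obtain ⟨n, hn⟩ := DalesDavie.exists_taylorNorm_iterate_lt_one hX hP hrad hk h1
  obtain ⟨η, C, hη, hC⟩ := exists_weighted_ddTerm_comp_le (φ := φ^[n + 1]) hX hP hM hna
    (DalesDavie.hasTaylorRadius_iterate_succ hX hP hrad n) hn
  refine ⟨n + 1, n.succ_pos, DalesDavie.isCompactOperator_of_weighted (C := C) (T ^ (n + 1)) hη
    fun f => ?_⟩
  have e : ((T ^ (n + 1)) f).1 = f.1 ∘ φ^[n + 1] :=
    funext (DalesDavie.pow_apply_eq_iterate hTφ (n + 1) f)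
  rw [e]
  exact hC f.1 f.2
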